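/- Let $A\in\mathbb{R}^{n\times n}_{\ge 0}$, $n\ge 2$, have zero diagonal and no zero row, and be balanceable, i.e. there is a positive diagonal matrix $D$ such that $DAD^{-1}$ has equal row and column sums: $r(DAD^{-1})=c(DAD^{-1})$. (This holds in particular if the directed graph $G_A=([n],\{(i,j):A_{ij}\ne 0\})$ is strongly connected.) Let $m$ be the number of nonzero entries of $A$, $A_{\min}$ its smallest nonzero entry, $\kappa=\sum_{ij}A_{ij}/A_{\min}$, and $d\in\mathbb{N}\cup\{\infty\}$ the diameter of $G_A$. Let $\epsilon\in(0,1)$, and for every $k\ge 0$ let $\sigma_k$ be an arbitrary ordering of $\{1,\dots,n\}$. An $\epsilon$-balancing of $A$ is a positive diagonal $D$ such that $M=DAD^{-1}$ satisfies $\|r(M)-c(M)\|_1\le\epsilon\sum_{ij}M_{ij}$. Osborne's algorithm starts at $u=0\in\mathbb{R}^n$; cycle $k=0,1,2,\dots$ runs through the indices $j$ in the order $\sigma_k$ and performs $$u_j\leftarrow u_j+\tfrac12\log c_j(M)-\tfrac12\log r_j(M),\qquad M=DAD^{-1},\quad D=\mathrm{diag}(e^{u_1},\dots,e^{u_n}).$$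 Consider the following implementation. Numbers are in fixed-point format with a sign, $p$ bits before and $p$ bits after the binary point. The unit-cost operations, with results rounded down, are: reading an input number, $+$, $-$, $\times$, halving, $\max$, $|\cdot|$, comparison, $\exp$, $\log$, and truncation to a given number of bits. The nonzero entries $A_{ij}$ are read in units of $A_{\min}$, and their logarithms are computed once and truncated to accuracy $\gamma=\Theta(\epsilon/n)$; afterwards $A$ is accessed only through them. Each update is computed by evaluating $\log c_j$ and $\log r_j$ as log-sum-exp with the maximum subtracted first, and the new coordinate is truncated to accuracy $\gamma'=\Theta(\epsilon^2)$. After each cycle the imbalance $\|r(M)-c(M)\|_1/\sum_{ij}M_{ij}$ is estimated in the same arithmetic, and the algorithm stops, with output $u$, once the estimate is at most $\epsilon/2$. Then the absolute constants in $p=\Theta(\log(n\kappa/\epsilon))$, $\gamma$ and $\gamma'$ can be chosen such that, for all such $A$, $\epsilon$ and $(\sigma_k)_k$, no operation overflows and the algorithm stops, with an output $u$ for which $\mathrm{diag}(e^{u_1},\dots,e^{u_n})$ is an $\epsilon$-balancing of $A$, after $$O\Big(\frac{m\log\kappa}{\epsilon}\min\Big\{\frac1\epsilon,d\Big\}\Big)$$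 arithmetic operations on numbers of $O(\log(n\kappa/\epsilon))$ bits, with absolute constants in both bounds. Moreover, up to multiplication of $A$ by a positive scalar, the output is that of finitely many cycles of Osborne's algorithm with the orderings $\sigma_k$ and with each update made up to an additive error of at most $2\gamma'$, applied to a matrix with the same nonzero positions as $A$ whose log-entries differ from those of $A$ by at most $2\gamma$. -/

import Mathlib

namespace Osborne

noncomputable section

/-! ### Matrix balancing -/

/-- The diagonal similarity scaling `D A D⁻¹`, where `D` is diagonal with entries `d`. -/
def scaled {n : ℕ} (A : Matrix (Fin n) (Fin n) ℝ) (d : Fin n → ℝ) : Matrix (Fin n) (Fin n) ℝ :=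
  Matrix.diagonal d * A * Matrix.diagonal (fun i => (d i)⁻¹)

/-- The `i`-th row sum. -/
def rowSum {n : ℕ} (M : Matrix (Fin n) (Fin n) ℝ) (i : Fin n) : ℝ := ∑ j, M i j

/-- The `i`-th column sum. -/
def colSum {n : ℕ} (M : Matrix (Fin n) (Fin n) ℝ) (i : Fin n) : ℝ := ∑ j, M j i

/-- `A` is balanceable: some positive diagonal scaling has equal row and column sums. -/
def IsBalanceable {n : ℕ} (A : Matrix (Fin n) (Fin n) ℝ) : Prop :=
  ∃ d : Fin n → ℝ, (∀ i, 0 < d i) ∧ ∀ i, rowSum (scaled A d) i = colSum (scaled A d) i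

/-- The normalized `ℓ₁` imbalance `‖r(M) - c(M)‖₁ / ∑ᵢⱼ Mᵢⱼ`. -/
def imbalance {n : ℕ} (M : Matrix (Fin n) (Fin n) ℝ) : ℝ :=
  (∑ i, |rowSum M i - colSum M i|) / ∑ i, ∑ j, M i j

/-- The positive diagonal matrix with entries `d` is an `ε`-balancing of `A`. -/
def IsEpsBalancing {n : ℕ} (A : Matrix (Fin n) (Fin n) ℝ) (ε : ℝ) (d : Fin n → ℝ) : Prop :=
  (∀ i, 0 < d i) ∧ imbalance (scaled A d) ≤ ε

/-- The number `m` of nonzero entries. -/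
def nnz {n : ℕ} (A : Matrix (Fin n) (Fin n) ℝ) : ℕ :=
  (Finset.univ.filter fun e : Fin n × Fin n => A e.1 e.2 ≠ 0).card

/-- The smallest nonzero entry (of a nonzero matrix with nonnegative entries). -/
def minEntry {n : ℕ} (A : Matrix (Fin n) (Fin n) ℝ) : ℝ :=
  sInf {x : ℝ | ∃ i j, A i j ≠ 0 ∧ A i j = x}

/-- The conditioning `κ = ∑ᵢⱼ Aᵢⱼ / min {Aᵢⱼ : Aᵢⱼ ≠ 0}`. -/
def kappa {n : ℕ} (A : Matrix (Fin n) (Fin n) ℝ) : ℝ := (∑ i, ∑ j, A i j) / minEntry A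

/-- `Walk A k i j`: the directed graph of `A` has a walk of length `k` from `i` to `j`. -/
def Walk {n : ℕ} (A : Matrix (Fin n) (Fin n) ℝ) : ℕ → Fin n → Fin n → Prop
  | 0, i, j => i = j
  | k + 1, i, j => ∃ l, A i l ≠ 0 ∧ Walk A k l j

/-- The diameter `d` of the directed graph of `A`; it is `⊤` if the graph is not
strongly connected. -/
def diam {n : ℕ} (A : Matrix (Fin n) (Fin n) ℝ) : ℕ∞ :=
  ⨆ (i : Fin n) (j : Fin n), ⨅ (k : ℕ) (_ : Walk A k i j), (k : ℕ∞)

/-- The real number `min {1/ε, d}`, which equals `1/ε` when `d = ⊤`. -/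
def minInvDiam {n : ℕ} (A : Matrix (Fin n) (Fin n) ℝ) (ε : ℝ) : ℝ :=
  (min (ENNReal.ofReal (1 / ε)) (ENat.toENNReal (diam A))).toReal

/-! ### Osborne's iteration in logarithmic coordinates, with inexact updates -/

/-- The value which Osborne's algorithm assigns to coordinate `j` of `u` in order to balance the
`j`-th row and column of `D A D⁻¹`, `D = diag (exp u)`. -/
def exactUpdate {n : ℕ} (A : Matrix (Fin n) (Fin n) ℝ) (u : Fin n → ℝ) (j : Fin n) : ℝ :=
  u j + 1 / 2 * Real.log (colSum (scaled A fun i => Real.exp (u i)) j)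
    - 1 / 2 * Real.log (rowSum (scaled A fun i => Real.exp (u i)) j)

/-- `v k t` is the iterate in cycle `k` after `t` updates, for the first `K` cycles of Osborne's
algorithm on `A`, started at `0`. Cycle `k` updates the coordinates in the order
`σ k 0, σ k 1, …, σ k (n-1)`, each up to an additive error of at most `δ`. -/
structure IsInexactOsborne {n : ℕ} (A : Matrix (Fin n) (Fin n) ℝ) (σ : ℕ → Equiv.Perm (Fin n))
    (δ : ℝ) (K : ℕ) (v : ℕ → ℕ → Fin n → ℝ) : Prop where
  init : v 0 0 = 0
  next : ∀ k < K, v (k + 1) 0 = v k n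
  step : ∀ k < K, ∀ t : Fin n, ∃ x : ℝ,
    |x - exactUpdate A (v k t) (σ k t)| ≤ δ ∧
      v k (t + 1) = Function.update (v k t) (σ k t) x

/-! ### Arithmetic on fixed-point numbers, with a count of the operations

A machine number is a word `w : ℤ` with `|w| < 2 ^ (2 p)`, i.e. a sign and `2 p` bits; it stands
for `w / 2 ^ p`. Thus there are `p` bits before and `p` bits after the binary point. Every
operation has unit cost, rounds its result down, and makes the run fail if the result
overflows. -/

/-- A run that carries the number of operations performed so far, and that may fail. -/
abbrev Run := StateT ℕ Option

/-- The real number that a word stands for. -/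
def val (p : ℕ) (w : ℤ) : ℝ := (w : ℝ) / 2 ^ p

/-- The length of a word in bits, including the sign. -/
def wordLength (p : ℕ) : ℕ := 2 * p + 1

/-- One operation with result `w`. -/
def emit (p : ℕ) (w : ℤ) : Run ℤ :=
  fun t => if |w| < 2 ^ (2 * p) then some (w, t + 1) else none

/-- Read a real input, rounded down to a word. -/
def read (p : ℕ) (x : ℝ) : Run ℤ := emit p ⌊x * 2 ^ p⌋

/-- Addition. -/
def add (p : ℕ) (x y : ℤ) : Run ℤ := emit p (x + y)

/-- Subtraction. -/
def sub (p : ℕ) (x y : ℤ) : Run ℤ := emit p (x - y)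

/-- Multiplication. -/
def mul (p : ℕ) (x y : ℤ) : Run ℤ := emit p ⌊val p x * val p y * 2 ^ p⌋

/-- Division by two. -/
def half (p : ℕ) (x : ℤ) : Run ℤ := emit p ⌊val p x / 2 * 2 ^ p⌋

/-- Maximum. -/
def vmax (p : ℕ) (x y : ℤ) : Run ℤ := emit p (max x y)

/-- Absolute value. -/
def vabs (p : ℕ) (x : ℤ) : Run ℤ := emit p |x|

/-- Exponential. -/
def vexp (p : ℕ) (x : ℤ) : Run ℤ := emit p ⌊Real.exp (val p x) * 2 ^ p⌋

/-- Natural logarithm, defined only for positive arguments. -/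
def vlog (p : ℕ) (x : ℤ) : Run ℤ :=
  if 0 < x then emit p ⌊Real.log (val p x) * 2 ^ p⌋ else failure

/-- Truncation (rounding down) to `q ≤ p` bits after the binary point. -/
def truncTo (p q : ℕ) (x : ℤ) : Run ℤ := emit p (2 ^ (p - q) * (x / 2 ^ (p - q)))

/-- Comparison. -/
def vle (x y : ℤ) : Run Bool := fun t => some (decide (x ≤ y), t + 1)

/-! ### The implementation of Osborne's algorithm -/

/-- The precisions of the implementation: the word format, and the numbers of bits after the
binary point to which log-entries and iterates are truncated. -/
structure Precision where
  /-- Words have `p` bits before and `p` bits after the binary point. -/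
  p : ℕ
  /-- Logarithms of entries are truncated to accuracy `2 ^ (-qLog)`. -/
  qLog : ℕ
  /-- Iterates are truncated to accuracy `2 ^ (-qIter)`. -/
  qIter : ℕ

/-- Words of length `Θ(log (n κ / ε))`, log-entries truncated to accuracy `Θ(ε / n)` and iterates
truncated to accuracy `Θ(ε²)`. -/
def Precision.choose (c₁ c₂ c₃ : ℝ) (n : ℕ) (κ ε : ℝ) : Precision where
  p := ⌈c₁ * Real.log (n * κ / ε)⌉₊
  qLog := ⌈Real.logb 2 (c₂ * n / ε)⌉₊
  qIter := ⌈Real.logb 2 (c₃ / ε ^ 2)⌉₊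

/-- The positions of the nonzero entries in row `i`. -/
def rowSupport {n : ℕ} (A : Matrix (Fin n) (Fin n) ℝ) (i : Fin n) : List (Fin n) :=
  (List.finRange n).filter fun j => A i j ≠ 0

/-- The positions of the nonzero entries in column `j`. -/
def colSupport {n : ℕ} (A : Matrix (Fin n) (Fin n) ℝ) (j : Fin n) : List (Fin n) :=
  (List.finRange n).filter fun i => A i j ≠ 0

/-- The positions of all nonzero entries, row by row. -/
def edges {n : ℕ} (A : Matrix (Fin n) (Fin n) ℝ) : List (Fin n × Fin n) :=
  (List.finRange n).flatMap fun i => (rowSupport A i).map fun j => (i, j)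

/-- Preprocessing: read each nonzero entry, in units of the smallest nonzero entry, and store
its truncated logarithm. Afterwards the entries are accessed only through these logarithms. -/
def logEntries {n : ℕ} (P : Precision) (A : Matrix (Fin n) (Fin n) ℝ) :
    Run (Fin n × Fin n → ℤ) :=
  (edges A).foldlM (init := fun _ => 0) fun L e => do
    let a ← read P.p (A e.1 e.2 / minEntry A)
    let l ← vlog P.p a
    let l ← truncTo P.p P.qLog l
    pure (Function.update L e l)

/-- The logarithm `(uᵢ - uⱼ) + Lᵢⱼ` of an entry of the scaled matrix, `e = (i, j)`. -/
def logScaled {n : ℕ} (p : ℕ) (L : Fin n × Fin n → ℤ) (u : Fin n → ℤ) (e : Fin n × Fin n) :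
    Run ℤ := do
  let x ← sub p (u e.1) (u e.2)
  add p x (L e)

/-- The maximum of a nonempty list. -/
def listMax (p : ℕ) : List ℤ → Run ℤ
  | [] => failure
  | z :: zs => zs.foldlM (vmax p) z

/-- The sum of `exp (z - M)` over a list. -/
def sumExp (p : ℕ) (M : ℤ) (zs : List ℤ) : Run ℤ :=
  zs.foldlM (init := 0) fun s z => do
    let x ← sub p z M
    let y ← vexp p x
    add p s y

/-- Log-sum-exp of a nonempty list, evaluated with the maximum subtracted first. -/
def logSumExp (p : ℕ) (zs : List ℤ) : Run ℤ := do
  let M ← listMax p zs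
  let s ← sumExp p M zs
  let l ← vlog p s
  add p M l

/-- The update of coordinate `j`. -/
def updateCoord {n : ℕ} (P : Precision) (A : Matrix (Fin n) (Fin n) ℝ) (L : Fin n × Fin n → ℤ)
    (u : Fin n → ℤ) (j : Fin n) : Run (Fin n → ℤ) := do
  let zc ← (colSupport A j).mapM fun i => logScaled P.p L u (i, j)
  let zr ← (rowSupport A j).mapM fun i => logScaled P.p L u (j, i)
  let c ← logSumExp P.p zc
  let r ← logSumExp P.p zr
  let x ← sub P.p c r
  let x ← half P.p x
  let x ← add P.p (u j) x
  let x ← truncTo P.p P.qIter x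
  pure (Function.update u j x)

/-- One cycle of updates, in the order `π 0, …, π (n-1)`. -/
def cycle {n : ℕ} (P : Precision) (A : Matrix (Fin n) (Fin n) ℝ) (L : Fin n × Fin n → ℤ)
    (π : Equiv.Perm (Fin n)) (u : Fin n → ℤ) : Run (Fin n → ℤ) :=
  (List.finRange n).foldlM (fun w t => updateCoord P A L w (π t)) u

/-- The termination test: is the estimated imbalance of the scaled matrix at most `ε / 2`? Here
`e` is the word for `ε`, and `M` the largest logarithm of an entry of the scaled matrix. -/
def balanceTest {n : ℕ} (P : Precision) (A : Matrix (Fin n) (Fin n) ℝ) (L : Fin n × Fin n → ℤ)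
    (e : ℤ) (u : Fin n → ℤ) : Run Bool := do
  let z ← (edges A).mapM (logScaled P.p L u)
  let M ← listMax P.p z
  let total ← sumExp P.p M z
  let diff ← (List.finRange n).foldlM (init := 0) fun s j => do
    let zr ← (rowSupport A j).mapM fun i => logScaled P.p L u (j, i)
    let zc ← (colSupport A j).mapM fun i => logScaled P.p L u (i, j)
    let r ← sumExp P.p M zr
    let c ← sumExp P.p M zc
    let x ← sub P.p r c
    let x ← vabs P.p x
    add P.p s x
  let e ← half P.p e
  let bound ← mul P.p e total
  vle diff bound

/-- Repeat: perform cycle number `k`, then test for termination. The result is the number of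
performed cycles and the final iterate. The run fails if the test has not succeeded when `fuel`
more cycles are done; otherwise the value of `fuel` has no influence. -/
def loop {n : ℕ} (P : Precision) (A : Matrix (Fin n) (Fin n) ℝ) (σ : ℕ → Equiv.Perm (Fin n))
    (L : Fin n × Fin n → ℤ) (e : ℤ) : (fuel : ℕ) → ℕ → (Fin n → ℤ) → Run (ℕ × (Fin n → ℤ))
  | 0, _, _ => failure
  | fuel + 1, k, u => do
    let w ← cycle P A L (σ k) u
    let b ← balanceTest P A L e w
    if b then pure (k + 1, w) else loop P A σ L e fuel (k + 1) w

/-- Osborne's algorithm with the orderings `σ 0, σ 1, …` of the updates, in finite precision. -/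
def osborne {n : ℕ} (P : Precision) (A : Matrix (Fin n) (Fin n) ℝ) (ε : ℝ)
    (σ : ℕ → Equiv.Perm (Fin n)) (fuel : ℕ) : Run (ℕ × (Fin n → ℤ)) := do
  let L ← logEntries P A
  let e ← read P.p ε
  loop P A σ L e fuel 0 fun _ => 0

/-- The run of the algorithm on the given input halts after `T` operations, none of which
overflows, having performed `K` cycles, and outputs the vector `u` of words. -/
def HaltsWith {n : ℕ} (P : Precision) (A : Matrix (Fin n) (Fin n) ℝ) (ε : ℝ)
    (σ : ℕ → Equiv.Perm (Fin n)) (T K : ℕ) (u : Fin n → ℤ) : Prop :=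
  ∃ fuel : ℕ, (osborne P A ε σ fuel).run 0 = some ((K, u), T)

end

end Osborne

/-! The potential Φ(u) = log ∑ B_ij exp(u_i - u_j) is convex. Its gradient is r - c divided by the
sum of the scaled entries, so the imbalance is the ℓ₁ norm of the gradient. The analysis is done for
the matrix B of truncated logarithms (`logMatrix`), whose nonzero entries are at least 1 and whose
sum is at most κ. Hence Φ(0) ≤ log κ and Φ ≥ 0 everywhere.

One cycle: balancing index j with current sums r, c lowers the sum of entries by (√r - √c)², up to
an error δ²(r + c) of second order. An update disturbs the indices balanced before, but in total by
at most |r - c| + 2δ(r + c). So the imbalance left after the cycle is controlled by the sum of the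
|r - c| met on the way, and by Cauchy-Schwarz this sum is controlled by the decrease. Whatever the
ordering, a cycle that ends with imbalance h ≥ 288δ lowers Φ by at least h²/144
(`potential_cycle_decrease`).

Counting: as long as h ≥ ε/4, this gives O(log κ / ε²) cycles. If the diameter d is finite, Φ ≤ log
κ bounds u_i - u_j by log κ along each edge, hence by d log κ along walks. Convexity
(`potential_sub_le`) then bounds the gap to the last iterate by R h with R = 2d log κ. A gap that
decreases by a multiple of its square over R² has an inverse that grows linearly, which gives O(R /
ε) cycles (`card_le_of_decrease_of_gap_le`). Comparing with the last iterate instead of a minimizer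
means that no exact balancing is needed; balanceability serves only to exclude zero columns.

Arithmetic: `RunsWithin` combines success, cost and postcondition of a run. An update increases the
sup norm of u by at most ½ log κ plus its error, so over the bounded number of cycles all magnitudes
stay polynomial in nκ/ε, and O(log(nκ/ε)) bits suffice. The termination test separates imbalance at
most 3ε/4 from imbalance at least ε/4 (`runsWithin_balanceTest`): a failed test makes the cycle
count towards the bound, a passed one leaves room for passing from B back to A. -/

namespace Osborne

variable {n : ℕ}

/-! ### Rescaling one row and column -/

/-- The scaling of `B` with logarithmic coordinates `u`. -/
noncomputable def expScaled {n : ℕ} (B : Matrix (Fin n) (Fin n) ℝ) (u : Fin n → ℝ) :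
    Matrix (Fin n) (Fin n) ℝ :=
  scaled B fun i => Real.exp (u i)

/-- The sum of all entries. -/
noncomputable def total {n : ℕ} (M : Matrix (Fin n) (Fin n) ℝ) : ℝ := ∑ i, ∑ j, M i j

/-- `M'` is `M` with row `j` multiplied and column `j` divided by `s`. -/
def IsRescaling {n : ℕ} (j : Fin n) (s : ℝ) (M M' : Matrix (Fin n) (Fin n) ℝ) : Prop :=
  ∀ a b, M' a b = (if a = j then s else 1) * M a b * (if b = j then s⁻¹ else 1)

theorem scaled_apply (A : Matrix (Fin n) (Fin n) ℝ) (d : Fin n → ℝ) (i j : Fin n) :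
    scaled A d i j = d i * A i j * (d j)⁻¹ := by
  simp [scaled, Matrix.diagonal_mul, Matrix.mul_diagonal]

theorem expScaled_apply (B : Matrix (Fin n) (Fin n) ℝ) (u : Fin n → ℝ) (i j : Fin n) :
    expScaled B u i j = B i j * Real.exp (u i - u j) := by
  rw [expScaled, scaled_apply, Real.exp_sub]
  field_simp

theorem total_eq_sum_rowSum (M : Matrix (Fin n) (Fin n) ℝ) : total M = ∑ i, rowSum M i := rfl

theorem total_eq_sum_colSum (M : Matrix (Fin n) (Fin n) ℝ) : total M = ∑ i, colSum M i :=
  Finset.sum_comm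

theorem imbalance_eq (M : Matrix (Fin n) (Fin n) ℝ) :
    imbalance M = (∑ i, |rowSum M i - colSum M i|) / total M := rfl

theorem expScaled_update (B : Matrix (Fin n) (Fin n) ℝ) (hd : ∀ i, B i i = 0) (u : Fin n → ℝ)
    (j : Fin n) (x : ℝ) :
    IsRescaling j (Real.exp (x - u j)) (expScaled B u) (expScaled B (Function.update u j x)) := by
  intro a b
  simp only [expScaled_apply]
  by_cases ha : a = j <;> by_cases hb : b = j
  · subst ha; subst hb; simp [hd]
  · subst ha
    simp only [Function.update_self, Function.update_of_ne hb, if_true, if_neg hb, mul_one]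
    rw [mul_left_comm, ← Real.exp_add]; ring_nf
  · subst hb
    simp only [Function.update_self, Function.update_of_ne ha, if_true, if_neg ha, one_mul]
    rw [mul_assoc, ← Real.exp_neg, ← Real.exp_add]; ring_nf
  · simp [Function.update_of_ne, ha, hb]

namespace IsRescaling

variable {j : Fin n} {s : ℝ} {M M' : Matrix (Fin n) (Fin n) ℝ}

theorem transpose (h : IsRescaling j s M M') : IsRescaling j s⁻¹ M.transpose M'.transpose := by
  intro a b
  simp only [Matrix.transpose_apply, h b a, inv_inv]
  ring

/-- A row other than j changes only in column j, and row j only by the common factor s. As M j j =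
0, the two effects never meet in one entry. -/
theorem rowSum_eq (h : IsRescaling j s M M') (hj : M j j = 0) (l : Fin n) :
    rowSum M' l = rowSum M l + M l j * (s⁻¹ - 1) + if l = j then (s - 1) * rowSum M j else 0 := by
  have key : ∀ b, M' l b = M l b + (if b = j then M l j * (s⁻¹ - 1) else 0)
      + (if l = j then (s - 1) * M j b else 0) := by
    intro b
    rw [h l b]
    by_cases hl : l = j <;> by_cases hb : b = j
    · subst hl; subst hb; simp [hj]
    · subst hl; simp [hb]; ring
    · subst hb; simp [hl]; ring
    · simp [hl, hb]
  unfold rowSum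
  rw [Finset.sum_congr rfl fun b _ => key b]
  simp only [Finset.sum_add_distrib, Finset.sum_ite_eq', Finset.mem_univ, if_true]
  by_cases hl : l = j <;> simp [hl, Finset.mul_sum]

theorem colSum_eq (h : IsRescaling j s M M') (hj : M j j = 0) (l : Fin n) :
    colSum M' l = colSum M l + M j l * (s - 1) + if l = j then (s⁻¹ - 1) * colSum M j else 0 := by
  have := h.transpose.rowSum_eq hj l
  rw [inv_inv] at this
  exact this

theorem rowSum_self (h : IsRescaling j s M M') (hj : M j j = 0) :
    rowSum M' j = s * rowSum M j := by
  rw [h.rowSum_eq hj, hj]; simp; ring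

theorem colSum_self (h : IsRescaling j s M M') (hj : M j j = 0) :
    colSum M' j = s⁻¹ * colSum M j := by
  rw [h.colSum_eq hj, hj]; simp; ring

theorem total_eq (h : IsRescaling j s M M') (hj : M j j = 0) :
    total M' = total M - rowSum M j - colSum M j + s * rowSum M j + s⁻¹ * colSum M j := by
  rw [total_eq_sum_rowSum, Finset.sum_congr rfl fun l _ => h.rowSum_eq hj l]
  simp only [Finset.sum_add_distrib, Finset.sum_ite_eq', Finset.mem_univ, if_true,
    ← Finset.sum_mul]
  rw [← total_eq_sum_rowSum]
  have : ∑ i, M i j = colSum M j := rfl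
  rw [this]; ring

/-- The change of the other row and column sums is bounded by that of row and column `j`. -/
theorem sum_change_le (h : IsRescaling j s M M') (hj : M j j = 0) (h0 : ∀ a b, 0 ≤ M a b)
    (V : Finset (Fin n)) (hV : j ∉ V) :
    ∑ l ∈ V, (|rowSum M' l - rowSum M l| + |colSum M' l - colSum M l|)
      ≤ |s * rowSum M j - rowSum M j| + |s⁻¹ * colSum M j - colSum M j| := by
  have e1 : ∀ l ∈ V, |rowSum M' l - rowSum M l| + |colSum M' l - colSum M l|
      = M l j * |s⁻¹ - 1| + M j l * |s - 1| := by
    intro l hl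
    have hlj : l ≠ j := fun e => hV (e ▸ hl)
    rw [h.rowSum_eq hj, h.colSum_eq hj, if_neg hlj, if_neg hlj]
    have a1 : rowSum M l + M l j * (s⁻¹ - 1) + 0 - rowSum M l = M l j * (s⁻¹ - 1) := by ring
    have a2 : colSum M l + M j l * (s - 1) + 0 - colSum M l = M j l * (s - 1) := by ring
    rw [a1, a2, abs_mul, abs_mul, abs_of_nonneg (h0 _ _), abs_of_nonneg (h0 _ _)]
  rw [Finset.sum_congr rfl e1, Finset.sum_add_distrib, ← Finset.sum_mul, ← Finset.sum_mul]
  have r1 : ∑ l ∈ V, M l j ≤ colSum M j :=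
    Finset.sum_le_sum_of_subset_of_nonneg (Finset.subset_univ _) fun _ _ _ => h0 _ _
  have r2 : ∑ l ∈ V, M j l ≤ rowSum M j :=
    Finset.sum_le_sum_of_subset_of_nonneg (Finset.subset_univ _) fun _ _ _ => h0 _ _
  have hr : 0 ≤ rowSum M j := Finset.sum_nonneg fun _ _ => h0 _ _
  have hc : 0 ≤ colSum M j := Finset.sum_nonneg fun _ _ => h0 _ _
  have a1 : |s * rowSum M j - rowSum M j| = rowSum M j * |s - 1| := by
    rw [← abs_of_nonneg hr, ← abs_mul, abs_of_nonneg hr]; ring_nf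
  have a2 : |s⁻¹ * colSum M j - colSum M j| = colSum M j * |s⁻¹ - 1| := by
    rw [← abs_of_nonneg hc, ← abs_mul, abs_of_nonneg hc]; ring_nf
  rw [a1, a2, add_comm]
  gcongr

end IsRescaling

/-! ### One inexact update -/

/-- Scalar estimates for the balancing of a row sum `r` and a column sum `c` with an additive
error `η` in the logarithmic coordinate. -/
theorem balancing_estimates {r c η δ s : ℝ} (hr : 0 < r) (hc : 0 < c) (hη : |η| ≤ δ) (hδ : δ ≤ 1)
    (hs : s = Real.exp (1 / 2 * Real.log c - 1 / 2 * Real.log r + η)) :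
    -r - c + s * r + s⁻¹ * c ≤ -(√r - √c) ^ 2 + δ ^ 2 * (r + c) ∧
    |s * r - r| + |s⁻¹ * c - c| ≤ |r - c| + 2 * δ * (r + c) ∧
    |s * r - s⁻¹ * c| ≤ 2 * δ * (r + c) ∧
    |r - c| ^ 2 ≤ 2 * (√r - √c) ^ 2 * (r + c) := by
  -- With r = a² and c = b² the exact update turns both sums into the geometric mean ab; the error η
  -- only multiplies them by exp(η) and exp(-η).
  obtain ⟨a, ha, rfl⟩ : ∃ a, 0 < a ∧ r = a ^ 2 := ⟨√r, Real.sqrt_pos.2 hr, (Real.sq_sqrt hr.le).symm⟩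
  obtain ⟨b, hb, rfl⟩ : ∃ a, 0 < a ∧ c = a ^ 2 := ⟨√c, Real.sqrt_pos.2 hc, (Real.sq_sqrt hc.le).symm⟩
  have hs' : s = b / a * Real.exp η := by
    rw [hs, Real.log_pow, Real.log_pow]
    have : 1 / 2 * (((2 : ℕ) : ℝ) * Real.log b) - 1 / 2 * (((2 : ℕ) : ℝ) * Real.log a) + η
        = Real.log b - Real.log a + η := by push_cast; ring
    rw [this, Real.exp_add, Real.exp_sub, Real.exp_log ha, Real.exp_log hb]
  have e1 : s * a ^ 2 = a * b * Real.exp η := by rw [hs']; field_simp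
  have e2 : s⁻¹ * b ^ 2 = a * b * Real.exp (-η) := by
    rw [hs', mul_inv, Real.exp_neg]; field_simp
  rw [e1, e2, Real.sqrt_sq ha.le, Real.sqrt_sq hb.le]
  have hδ0 : 0 ≤ δ := (abs_nonneg _).trans hη
  have hab : 0 < a * b := mul_pos ha hb
  have hab2 : 2 * (a * b) ≤ a ^ 2 + b ^ 2 := by nlinarith [sq_nonneg (a - b)]
  have hη1 : |η| ≤ 1 := hη.trans hδ
  have x1 := Real.abs_exp_sub_one_sub_id_le hη1
  have x2 := Real.abs_exp_sub_one_sub_id_le (x := -η) (by rwa [abs_neg])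
  have y1 := Real.abs_exp_sub_one_le hη1
  have y2 := Real.abs_exp_sub_one_le (x := -η) (by rwa [abs_neg])
  rw [abs_neg] at y2
  have hsq : η ^ 2 ≤ δ ^ 2 := by rw [← sq_abs]; gcongr
  have z1 : |Real.exp η - 1| ≤ 2 * δ := by linarith
  have z2 : |Real.exp (-η) - 1| ≤ 2 * δ := by linarith
  refine ⟨?_, ?_, ?_, ?_⟩
  -- The terms of first order in η cancel, so an inexact update costs the potential only O(δ²).
  · have : Real.exp η + Real.exp (-η) - 2 ≤ 2 * δ ^ 2 := by
      have := (abs_le.1 x1).2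
      have := (abs_le.1 x2).2
      have : (-η) ^ 2 = η ^ 2 := by ring
      linarith
    have h1 := mul_le_mul_of_nonneg_left this hab.le
    have h2 := mul_le_mul_of_nonneg_right hab2 (sq_nonneg δ)
    nlinarith
  · have t1 : |a * b * Real.exp η - a ^ 2| ≤ |a * b - a ^ 2| + a * b * (2 * δ) := by
      have : a * b * Real.exp η - a ^ 2 = (a * b - a ^ 2) + a * b * (Real.exp η - 1) := by ring
      rw [this]
      refine (abs_add_le _ _).trans ?_
      rw [abs_mul (a * b), abs_of_pos hab]
      gcongr
    have t2 : |a * b * Real.exp (-η) - b ^ 2| ≤ |a * b - b ^ 2| + a * b * (2 * δ) := by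
      have : a * b * Real.exp (-η) - b ^ 2 = (a * b - b ^ 2) + a * b * (Real.exp (-η) - 1) := by
        ring
      rw [this]
      refine (abs_add_le _ _).trans ?_
      rw [abs_mul (a * b), abs_of_pos hab]
      gcongr
    -- The number ab lies between a² and b², so its distances to them add up.
    have t3 : |a * b - a ^ 2| + |a * b - b ^ 2| = |a ^ 2 - b ^ 2| := by
      have f1 : a * b - a ^ 2 = a * (b - a) := by ring
      have f2 : a * b - b ^ 2 = -(b * (b - a)) := by ring
      have f3 : a ^ 2 - b ^ 2 = -((a + b) * (b - a)) := by ring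
      rw [f1, f2, f3, abs_neg, abs_neg, abs_mul, abs_mul, abs_mul, abs_of_pos ha, abs_of_pos hb,
        abs_of_pos (add_pos ha hb)]
      ring
    nlinarith
  · have : a * b * Real.exp η - a * b * Real.exp (-η)
        = a * b * ((Real.exp η - 1) - (Real.exp (-η) - 1)) := by ring
    rw [this, abs_mul, abs_of_pos hab]
    have : |(Real.exp η - 1) - (Real.exp (-η) - 1)| ≤ 4 * δ := by
      refine (abs_sub _ _).trans ?_
      linarith
    have h1 := mul_le_mul_of_nonneg_left this hab.le
    nlinarith
  · rw [sq_abs]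
    have : (a ^ 2 - b ^ 2) ^ 2 = (a - b) ^ 2 * (a + b) ^ 2 := by ring
    rw [this]
    nlinarith [mul_nonneg (sq_nonneg (a - b)) (sq_nonneg (a - b))]

/-- A nonnegative matrix with zero diagonal and without zero rows or columns. -/
structure IsAdmissible (B : Matrix (Fin n) (Fin n) ℝ) : Prop where
  nonneg : ∀ i j, 0 ≤ B i j
  diag : ∀ i, B i i = 0
  row : ∀ i, ∃ j, 0 < B i j
  col : ∀ j, ∃ i, 0 < B i j

theorem IsAdmissible.expScaled_nonneg {B : Matrix (Fin n) (Fin n) ℝ}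
    (hB : IsAdmissible B) (u : Fin n → ℝ) (i j : Fin n) : 0 ≤ expScaled B u i j := by
  rw [expScaled_apply]; exact mul_nonneg (hB.nonneg _ _) (Real.exp_pos _).le

theorem IsAdmissible.expScaled_diag {B : Matrix (Fin n) (Fin n) ℝ}
    (hB : IsAdmissible B) (u : Fin n → ℝ) (i : Fin n) : expScaled B u i i = 0 := by
  rw [expScaled_apply, hB.diag, zero_mul]

theorem IsAdmissible.rowSum_pos {B : Matrix (Fin n) (Fin n) ℝ}
    (hB : IsAdmissible B) (u : Fin n → ℝ) (i : Fin n) : 0 < rowSum (expScaled B u) i := by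
  obtain ⟨j, hj⟩ := hB.row i
  refine Finset.sum_pos' (fun _ _ => hB.expScaled_nonneg u _ _) ⟨j, Finset.mem_univ _, ?_⟩
  rw [expScaled_apply]; exact mul_pos hj (Real.exp_pos _)

theorem IsAdmissible.colSum_pos {B : Matrix (Fin n) (Fin n) ℝ}
    (hB : IsAdmissible B) (u : Fin n → ℝ) (i : Fin n) : 0 < colSum (expScaled B u) i := by
  obtain ⟨j, hj⟩ := hB.col i
  refine Finset.sum_pos' (fun _ _ => hB.expScaled_nonneg u _ _) ⟨j, Finset.mem_univ _, ?_⟩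
  rw [expScaled_apply]; exact mul_pos hj (Real.exp_pos _)

theorem IsAdmissible.total_pos {B : Matrix (Fin n) (Fin n) ℝ}
    (hB : IsAdmissible B) (u : Fin n → ℝ) (hn : 0 < n) : 0 < total (expScaled B u) :=
  Finset.sum_pos (fun i _ => hB.rowSum_pos u i) ⟨⟨0, hn⟩, Finset.mem_univ _⟩

theorem IsAdmissible.imbalance_le_two {B : Matrix (Fin n) (Fin n) ℝ}
    (hB : IsAdmissible B) (u : Fin n → ℝ) (hn : 0 < n) : imbalance (expScaled B u) ≤ 2 := by
  rw [imbalance_eq, div_le_iff₀ (hB.total_pos u hn)]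
  calc ∑ i, |rowSum (expScaled B u) i - colSum (expScaled B u) i|
      ≤ ∑ i, (rowSum (expScaled B u) i + colSum (expScaled B u) i) := by
        refine Finset.sum_le_sum fun i _ => ?_
        have := hB.rowSum_pos u i
        have := hB.colSum_pos u i
        rw [abs_le]; constructor <;> linarith
    _ = 2 * total (expScaled B u) := by
        rw [Finset.sum_add_distrib, ← total_eq_sum_rowSum, ← total_eq_sum_colSum]; ring

/-! ### One cycle of updates -/

/-- Accumulated estimates for the updates performed so far: `X`, `Y`, `D` are the sums of
`|r - c|`, `r + c` and `(√r - √c)²` over the updates, and the coordinates in `U` are those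
already updated. -/
theorem partial_cycle_estimates {B : Matrix (Fin n) (Fin n) ℝ} (hB : IsAdmissible B) {δ : ℝ}
    (hδ : δ ≤ 1) (π : Equiv.Perm (Fin n)) (v : ℕ → Fin n → ℝ)
    (hv : ∀ t : Fin n, ∃ x : ℝ, |x - exactUpdate B (v t) (π t)| ≤ δ ∧
      v (t + 1) = Function.update (v t) (π t) x) (t : ℕ) (ht : t ≤ n) :
    ∃ X Y D : ℝ, 0 ≤ X ∧ 0 ≤ Y ∧ 0 ≤ D ∧ X ^ 2 ≤ 2 * D * Y ∧
      total (expScaled B (v t)) ≤ total (expScaled B (v 0)) - D + δ ^ 2 * Y ∧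
      ∑ l with ¬ (π.symm l : ℕ) < t, (rowSum (expScaled B (v t)) l + colSum (expScaled B (v t)) l)
        + Y ≤ 2 * total (expScaled B (v 0)) + X + 2 * δ * Y ∧
      ∑ l with (π.symm l : ℕ) < t, |rowSum (expScaled B (v t)) l - colSum (expScaled B (v t)) l|
        ≤ X + 4 * δ * Y := by
  induction t with
  | zero =>
    refine ⟨0, 0, 0, le_rfl, le_rfl, le_rfl, by norm_num, by simp, ?_, by simp⟩
    have : ∑ l, (rowSum (expScaled B (v 0)) l + colSum (expScaled B (v 0)) l)
        = 2 * total (expScaled B (v 0)) := by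
      rw [Finset.sum_add_distrib, ← total_eq_sum_rowSum, ← total_eq_sum_colSum]; ring
    simp [this]
  | succ t ih =>
    obtain ⟨X, Y, D, hX, hY, hD, hXY, hS, hR, hG⟩ := ih (by omega)
    obtain ⟨x, hx, hvx⟩ := hv ⟨t, ht⟩
    set j := π ⟨t, ht⟩ with hj
    simp only at hx hvx
    set M := expScaled B (v t) with hM
    have hres := expScaled_update B hB.diag (v t) j x
    rw [← hvx, ← hM] at hres
    set M' := expScaled B (v (t + 1)) with hM'
    set s := Real.exp (x - v t j) with hs
    have hr : 0 < rowSum M j := hB.rowSum_pos _ _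
    have hc : 0 < colSum M j := hB.colSum_pos _ _
    have hjj : M j j = 0 := hB.expScaled_diag _ _
    have h0 : ∀ a b, 0 ≤ M a b := hB.expScaled_nonneg _
    set r := rowSum M j with hrdef
    set c := colSum M j with hcdef
    obtain ⟨q1, q2, q3, q4⟩ := balancing_estimates (s := s) hr hc hx hδ (by
      rw [hs]; congr 1
      show _ = _ + (x - (v t j + 1 / 2 * Real.log c - 1 / 2 * Real.log r))
      ring)
    have hsplit : Finset.univ.filter (fun l => ¬ (π.symm l : ℕ) < t)
        = insert j (Finset.univ.filter fun l => ¬ (π.symm l : ℕ) < t + 1) := by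
      ext l
      simp only [Finset.mem_filter, Finset.mem_univ, true_and, Finset.mem_insert, hj]
      rw [← Equiv.symm_apply_eq, Fin.ext_iff]
      simp only
      omega
    have hsplit' : Finset.univ.filter (fun l => (π.symm l : ℕ) < t + 1)
        = insert j (Finset.univ.filter fun l => (π.symm l : ℕ) < t) := by
      ext l
      simp only [Finset.mem_filter, Finset.mem_univ, true_and, Finset.mem_insert, hj]
      rw [← Equiv.symm_apply_eq, Fin.ext_iff]
      simp only
      omega
    have hn1 : j ∉ Finset.univ.filter fun l => ¬ (π.symm l : ℕ) < t + 1 := by simp [hj]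
    have hn2 : j ∉ Finset.univ.filter fun l => (π.symm l : ℕ) < t := by simp [hj]
    have c1 := hres.sum_change_le hjj h0 _ hn1
    have c2 := hres.sum_change_le hjj h0 _ hn2
    rw [hsplit, Finset.sum_insert hn1] at hR
    refine ⟨X + |r - c|, Y + (r + c), D + (√r - √c) ^ 2, by positivity, by positivity,
      by positivity, ?_, ?_, ?_, ?_⟩
    · have hd : 0 ≤ (√r - √c) ^ 2 := sq_nonneg _
      generalize (√r - √c) ^ 2 = d at *
      have hz : 0 ≤ |r - c| := abs_nonneg _
      generalize |r - c| = z at *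
      have hy : 0 ≤ r + c := by positivity
      generalize r + c = y at *
      -- The inductive step of Cauchy-Schwarz: the cross term of (X + z)² is handled by the
      -- inequality of the means.
      have h2 : 2 * (X * z) ≤ 2 * d * Y + 2 * D * y := by
        have p1 : (X * z) ^ 2 ≤ (2 * D * Y) * (2 * d * y) := by
          rw [mul_pow]; gcongr
        have p2 : (2 * (X * z)) ^ 2 ≤ (2 * d * Y + 2 * D * y) ^ 2 := by
          nlinarith [sq_nonneg (d * Y - D * y)]
        exact le_of_sq_le_sq p2 (by positivity)
      nlinarith
    · rw [hres.total_eq hjj]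
      linarith
    · have e : ∑ l with ¬ (π.symm l : ℕ) < t + 1, (rowSum M' l + colSum M' l)
          ≤ ∑ l with ¬ (π.symm l : ℕ) < t + 1, (rowSum M l + colSum M l)
            + ∑ l with ¬ (π.symm l : ℕ) < t + 1,
              (|rowSum M' l - rowSum M l| + |colSum M' l - colSum M l|) := by
        rw [← Finset.sum_add_distrib]
        refine Finset.sum_le_sum fun l _ => ?_
        have := le_abs_self (rowSum M' l - rowSum M l)
        have := le_abs_self (colSum M' l - colSum M l)
        linarith
      linarith
    -- Index j itself contributes at most 2δ(r + c) after its update, and the indices before it are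
    -- disturbed by at most |r - c| + 2δ(r + c); this explains the 4δ.
    · rw [hsplit', Finset.sum_insert hn2, hres.rowSum_self hjj, hres.colSum_self hjj]
      have e : ∑ l with (π.symm l : ℕ) < t, |rowSum M' l - colSum M' l|
          ≤ ∑ l with (π.symm l : ℕ) < t, |rowSum M l - colSum M l|
            + ∑ l with (π.symm l : ℕ) < t,
              (|rowSum M' l - rowSum M l| + |colSum M' l - colSum M l|) := by
        rw [← Finset.sum_add_distrib]
        refine Finset.sum_le_sum fun l _ => ?_
        have : rowSum M' l - colSum M' l = (rowSum M l - colSum M l)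
          + (rowSum M' l - rowSum M l) - (colSum M' l - colSum M l) := by ring
        rw [this]
        have := abs_sub (rowSum M l - colSum M l + (rowSum M' l - rowSum M l))
          (colSum M' l - colSum M l)
        have := abs_add_le (rowSum M l - colSum M l) (rowSum M' l - rowSum M l)
        linarith
      linarith

/-- The logarithmic potential. -/
noncomputable def potential (B : Matrix (Fin n) (Fin n) ℝ) (u : Fin n → ℝ) : ℝ :=
  Real.log (total (expScaled B u))

/-- One cycle of inexact updates decreases the potential by a multiple of the square of the final
imbalance, unless this imbalance is of the order of the errors. -/
theorem potential_cycle_decrease {B : Matrix (Fin n) (Fin n) ℝ} (hB : IsAdmissible B)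
    (hn : 0 < n) {δ : ℝ} (hδ0 : 0 ≤ δ) (hδ : δ ≤ 1 / 8) (π : Equiv.Perm (Fin n))
    (v : ℕ → Fin n → ℝ)
    (hv : ∀ t : Fin n, ∃ x : ℝ, |x - exactUpdate B (v t) (π t)| ≤ δ ∧
      v (t + 1) = Function.update (v t) (π t) x)
    (him : 288 * δ ≤ imbalance (expScaled B (v n))) :
    imbalance (expScaled B (v n)) ^ 2 / 144 ≤ potential B (v 0) - potential B (v n) := by
  obtain ⟨X, Y, D, hX, hY, hD, hXY, hS, hR, hG⟩ :=
    partial_cycle_estimates hB (by linarith) π v hv n le_rfl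
  have f1 : Finset.univ.filter (fun l => ¬ (π.symm l : ℕ) < n) = ∅ := by
    ext l; simp
  have f2 : Finset.univ.filter (fun l => (π.symm l : ℕ) < n) = Finset.univ := by
    ext l; simp
  rw [f1, Finset.sum_empty] at hR
  rw [f2] at hG
  have hpe := hB.total_pos (v n) hn
  have hp0 := hB.total_pos (v 0) hn
  have him2 := hB.imbalance_le_two (v n) hn
  have hG' : imbalance (expScaled B (v n)) * total (expScaled B (v n)) ≤ X + 4 * δ * Y := by
    rw [imbalance_eq, div_mul_cancel₀ _ hpe.ne']; exact hG
  unfold potential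
  rw [← Real.log_div hp0.ne' hpe.ne']
  generalize imbalance (expScaled B (v n)) = h at *
  generalize total (expScaled B (v n)) = S at *
  generalize total (expScaled B (v 0)) = S0 at *
  have hh : 0 ≤ h := le_trans (by positivity) him
  -- Since S > 0, D ≤ S0 + δ²Y. Then X ≤ Y/4 + 2D can be absorbed into Y ≤ 2 S0 + X + 2δY.
  have hYb : Y ≤ 9 * S0 := by
    have k1 : X ≤ Y / 4 + 2 * D := by
      refine le_of_sq_le_sq ?_ (by positivity)
      nlinarith [sq_nonneg (Y / 4 - 2 * D)]
    have k2 : δ ^ 2 * Y ≤ 1 / 64 * Y := by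
      gcongr; nlinarith
    have k3 : 2 * δ * Y ≤ 1 / 4 * Y := by
      gcongr; linarith
    linarith
  -- If the sum of entries has dropped below half, the potential has decreased by log 2, which
  -- exceeds h²/144 because h ≤ 2. Otherwise S is comparable to S0, and the threshold 288δ makes the
  -- error term 36δ at most h/8.
  rcases le_or_gt (S0 / 2) S with hcase | hcase
  · have hδY : 4 * δ * Y ≤ 36 * δ * S0 := by nlinarith
    have k1 : h * (S0 / 2) ≤ X + 36 * δ * S0 := by
      have := mul_le_mul_of_nonneg_left hcase hh
      linarith
    have k2 : 3 / 8 * h * S0 ≤ X := by nlinarith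
    have k3 : (3 / 8 * h * S0) ^ 2 ≤ 18 * D * S0 := by
      calc (3 / 8 * h * S0) ^ 2 ≤ X ^ 2 := by gcongr
        _ ≤ 2 * D * Y := hXY
        _ ≤ 2 * D * (9 * S0) := by gcongr
        _ = 18 * D * S0 := by ring
    have k4 : h ^ 2 * S0 / 128 ≤ D := by
      have : h ^ 2 * S0 / 128 * S0 ≤ D * S0 := by nlinarith
      exact le_of_mul_le_mul_right this hp0
    have k5 : δ ^ 2 * Y ≤ h ^ 2 * S0 / 9216 := by
      have : δ ^ 2 ≤ (h / 288) ^ 2 := by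
        gcongr; linarith
      calc δ ^ 2 * Y ≤ (h / 288) ^ 2 * (9 * S0) := by gcongr
        _ = h ^ 2 * S0 / 9216 := by ring
    have k6 : S ≤ S0 - h ^ 2 * S0 / 144 := by
      have : 0 ≤ h ^ 2 * S0 := by positivity
      linarith
    have k7 : h ^ 2 / 144 ≤ 1 - S / S0 := by
      have : S / S0 ≤ 1 - h ^ 2 / 144 := by
        rw [div_le_iff₀ hp0]; linarith
      linarith
    have k8 := Real.one_sub_inv_le_log_of_pos (div_pos hp0 hpe)
    rw [inv_div] at k8
    linarith
  · have k1 : 2 ≤ S0 / S := by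
      rw [le_div_iff₀ hpe]; linarith
    have k2 : Real.log 2 ≤ Real.log (S0 / S) := Real.log_le_log (by norm_num) k1
    have k3 := Real.log_two_gt_d9
    nlinarith

/-! ### Bounds for the potential -/

theorem IsAdmissible.entry_le_total {B : Matrix (Fin n) (Fin n) ℝ} (hB : IsAdmissible B)
    (u : Fin n → ℝ) (i j : Fin n) : expScaled B u i j ≤ total (expScaled B u) := by
  calc expScaled B u i j ≤ rowSum (expScaled B u) i :=
        Finset.single_le_sum (f := fun b => expScaled B u i b)
          (fun b _ => hB.expScaled_nonneg u i b) (Finset.mem_univ j)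
    _ ≤ total (expScaled B u) :=
        Finset.single_le_sum (f := fun a => rowSum (expScaled B u) a)
          (fun a _ => (hB.rowSum_pos u a).le) (Finset.mem_univ i)

/-- In the row of a maximal coordinate of u the scaling only enlarges entries, so a nonzero entry
there remains at least 1. -/
theorem potential_nonneg {B : Matrix (Fin n) (Fin n) ℝ} (hB : IsAdmissible B) (hn : 0 < n)
    (h1 : ∀ i j, 0 < B i j → 1 ≤ B i j) (u : Fin n → ℝ) : 0 ≤ potential B u := by
  have : Nonempty (Fin n) := ⟨⟨0, hn⟩⟩
  obtain ⟨i, hi⟩ := Finite.exists_max u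
  obtain ⟨j, hj⟩ := hB.row i
  refine Real.log_nonneg (le_trans ?_ (hB.entry_le_total u i j))
  rw [expScaled_apply]
  exact one_le_mul_of_one_le_of_one_le (h1 _ _ hj) (Real.one_le_exp (sub_nonneg.2 (hi j)))

/-- A single scaled entry, which is at least exp(u_i - u_j), cannot exceed the sum of all. -/
theorem sub_le_of_potential_le {B : Matrix (Fin n) (Fin n) ℝ} (hB : IsAdmissible B) (hn : 0 < n)
    (h1 : ∀ i j, 0 < B i j → 1 ≤ B i j) {u : Fin n → ℝ} {b : ℝ} (hu : potential B u ≤ b)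
    {i j : Fin n} (hij : 0 < B i j) : u i - u j ≤ b := by
  rw [← Real.exp_le_exp]
  have ht : total (expScaled B u) ≤ Real.exp b := by
    rw [← Real.exp_log (hB.total_pos u hn)]; exact Real.exp_le_exp.2 hu
  refine le_trans ?_ ((hB.entry_le_total u i j).trans ht)
  rw [expScaled_apply]
  exact le_mul_of_one_le_left (Real.exp_pos _).le (h1 _ _ hij)

theorem sub_le_of_walk {A : Matrix (Fin n) (Fin n) ℝ} {u : Fin n → ℝ} {b : ℝ}
    (h : ∀ i j, A i j ≠ 0 → u i - u j ≤ b) (k : ℕ) {i j : Fin n} (hw : Walk A k i j) :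
    u i - u j ≤ k * b := by
  induction k generalizing i with
  | zero => obtain rfl : i = j := hw; simp
  | succ k ih =>
    obtain ⟨l, hl, hw⟩ := hw
    have := h _ _ hl
    have := ih hw
    push_cast; linarith

theorem exists_walk_of_diam_eq {A : Matrix (Fin n) (Fin n) ℝ} {d : ℕ} (hd : diam A = d)
    (i j : Fin n) : ∃ k ≤ d, Walk A k i j := by
  have h : (⨅ (k : ℕ) (_ : Walk A k i j), (k : ℕ∞)) ≤ d := by
    rw [← hd]
    exact le_iSup₂_of_le i j le_rfl
  by_contra! hc
  have : ((d + 1 : ℕ) : ℕ∞) ≤ ⨅ (k : ℕ) (_ : Walk A k i j), (k : ℕ∞) := by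
    refine le_iInf₂ fun k hk => ?_
    have : d < k := by
      by_contra hlt
      exact hc k (by omega) hk
    exact_mod_cast this
  have := this.trans h
  norm_cast at this
  omega

theorem one_le_diam (hn : 2 ≤ n) (A : Matrix (Fin n) (Fin n) ℝ) : 1 ≤ diam A := by
  refine le_iSup₂_of_le (⟨0, by omega⟩ : Fin n) (⟨1, by omega⟩ : Fin n) ?_
  refine le_iInf₂ fun k hk => ?_
  rcases k with _ | k
  · exact absurd (show (⟨0, by omega⟩ : Fin n) = ⟨1, by omega⟩ from hk) (by simp)
  · push_cast; exact le_add_self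

/-- Convexity of the potential: the gap to any other point is controlled by the imbalance. -/
theorem potential_sub_le {B : Matrix (Fin n) (Fin n) ℝ} (hB : IsAdmissible B) (hn : 0 < n)
    (u w : Fin n → ℝ) {ρ : ℝ} (hρ : ∀ i j, |(u i - w i) - (u j - w j)| ≤ ρ) :
    potential B u - potential B w ≤ ρ * imbalance (expScaled B u) := by
  set M := expScaled B u with hM
  set S := total M with hS
  have hSpos : 0 < S := hB.total_pos u hn
  set e : Fin n → ℝ := fun i => w i - u i with he
  set z : Fin n → Fin n → ℝ := fun i j => e i - e j with hz
  set m : ℝ := (∑ i, ∑ j, M i j * z i j) / S with hm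
  have hW : ∀ i j, expScaled B w i j = M i j * Real.exp (z i j) := by
    intro i j
    rw [hM, expScaled_apply, expScaled_apply, mul_assoc, ← Real.exp_add]
    simp only [hz, he]; ring_nf
  have hsum : Real.exp m * S ≤ total (expScaled B w) := by
    -- Jensen's inequality for exp by way of its tangent at the weighted mean m of the z i j; after
    -- summation the linear terms cancel.
    have h1 : ∀ i j, Real.exp m * (M i j + M i j * z i j - m * M i j) ≤ expScaled B w i j := by
      intro i j
      have h2 : Real.exp (z i j) = Real.exp m * Real.exp (z i j - m) := by
        rw [← Real.exp_add]; ring_nf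
      have h3 := Real.add_one_le_exp (z i j - m)
      have h4 : 0 ≤ M i j := hB.expScaled_nonneg u i j
      have h5 : 0 ≤ Real.exp m * M i j := mul_nonneg (Real.exp_pos _).le h4
      rw [hW, h2]
      nlinarith [mul_le_mul_of_nonneg_left h3 h5]
    calc Real.exp m * S = ∑ i, ∑ j, Real.exp m * (M i j + M i j * z i j - m * M i j) := by
          simp only [← Finset.mul_sum, Finset.sum_sub_distrib, Finset.sum_add_distrib]
          have : ∑ i, ∑ j, M i j = S := rfl
          rw [this]
          have : ∑ i, ∑ j, M i j * z i j = m * S := by rw [hm, div_mul_cancel₀ _ hSpos.ne']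
          rw [this]; ring
      _ ≤ total (expScaled B w) :=
          Finset.sum_le_sum fun i _ => Finset.sum_le_sum fun j _ => h1 i j
  have hlog : m + Real.log S ≤ potential B w := by
    have := Real.log_le_log (mul_pos (Real.exp_pos m) hSpos) hsum
    rwa [Real.log_mul (Real.exp_pos m).ne' hSpos.ne', Real.log_exp] at this
  -- As r - c sums to zero, e may be shifted by a constant; this is why a bound on differences of
  -- coordinates of u - w suffices.
  have hgrad : ∑ i, ∑ j, M i j * z i j
      = ∑ i, (rowSum M i - colSum M i) * (e i - e ⟨0, hn⟩) := by
    have h1 : ∑ i, ∑ j, M i j * z i j = ∑ i, rowSum M i * e i - ∑ j, colSum M j * e j := by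
      simp only [hz, mul_sub, Finset.sum_sub_distrib]
      congr 1
      · simp only [rowSum, Finset.sum_mul]
      · rw [Finset.sum_comm]; simp only [colSum, Finset.sum_mul]
    have h2 : ∑ i, (rowSum M i - colSum M i) = 0 := by
      rw [Finset.sum_sub_distrib, ← total_eq_sum_rowSum, ← total_eq_sum_colSum, sub_self]
    have h3 : ∑ i, (rowSum M i - colSum M i) * (e i - e ⟨0, hn⟩)
        = ∑ i, rowSum M i * e i - ∑ j, colSum M j * e j
          - (∑ i, (rowSum M i - colSum M i)) * e ⟨0, hn⟩ := by
      rw [Finset.sum_mul, ← Finset.sum_sub_distrib, ← Finset.sum_sub_distrib]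
      exact Finset.sum_congr rfl fun i _ => by ring
    rw [h1, h3, h2]; ring
  have hbound : -(ρ * ∑ i, |rowSum M i - colSum M i|) ≤ ∑ i, ∑ j, M i j * z i j := by
    rw [hgrad, Finset.mul_sum, ← Finset.sum_neg_distrib]
    refine Finset.sum_le_sum fun i _ => ?_
    have h1 : |e i - e ⟨0, hn⟩| ≤ ρ := by
      rw [← abs_neg]
      convert hρ i ⟨0, hn⟩ using 2
      simp only [he]; ring
    have h2 := neg_abs_le ((rowSum M i - colSum M i) * (e i - e ⟨0, hn⟩))
    rw [abs_mul] at h2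
    have h3 := mul_le_mul_of_nonneg_left h1 (abs_nonneg (rowSum M i - colSum M i))
    linarith
  have hm' : -(ρ * imbalance M) ≤ m := by
    rw [hm, imbalance_eq, le_div_iff₀ hSpos]
    calc -(ρ * ((∑ i, |rowSum M i - colSum M i|) / total M)) * S
        = -(ρ * ∑ i, |rowSum M i - colSum M i|) := by rw [← hS]; field_simp
      _ ≤ _ := hbound
  have : potential B u = Real.log S := rfl
  linarith

/-! ### The number of cycles -/

/-- Each cycle with imbalance at least ε/4 uses up (ε/4)²/144 = ε²/2304 of the potential. -/
theorem card_mul_le_of_decrease {g h : ℕ → ℝ} {ε : ℝ} (hε : 0 < ε) (N : ℕ)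
    (hg : ∀ k < N, h (k + 1) ^ 2 / 144 ≤ g k - g (k + 1)) (hh : ∀ k < N, ε / 4 ≤ h (k + 1)) :
    N * (ε ^ 2 / 2304) ≤ g 0 - g N := by
  induction N with
  | zero => simp
  | succ N ih =>
    have h1 := ih (fun k hk => hg k (by omega)) (fun k hk => hh k (by omega))
    have h2 := hg N (by omega)
    have h3 := hh N (by omega)
    have h4 : (ε / 4) ^ 2 ≤ h (N + 1) ^ 2 := by gcongr
    push_cast
    nlinarith

/-- The usual argument for gradient-type methods on convex functions: a gap at most R h and a
decrease of h²/144 force the inverse gap to grow by a constant over R² in each step. -/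
theorem card_le_of_decrease_of_gap_le {g h : ℕ → ℝ} {ε R : ℝ} (hε : 0 < ε) (hε1 : ε < 1)
    (hR : 1 / 2 ≤ R) (N : ℕ) (hg : ∀ k < N, h (k + 1) ^ 2 / 144 ≤ g k - g (k + 1))
    (hh : ∀ k < N, ε / 4 ≤ h (k + 1)) (h0 : g 0 - g N ≤ R)
    (hgap : ∀ k < N, g (k + 1) - g N ≤ R * h (k + 1)) :
    (N : ℝ) ≤ 4608 * R / ε := by
  have hR0 : 0 < R := by linarith
  have hanti : ∀ k < N, g (k + 1) ≤ g k := fun k hk => by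
    have := hg k hk
    have := sq_nonneg (h (k + 1))
    linarith
  have hge : ∀ k ≤ N, g N ≤ g k := by
    intro k hk
    induction hk using Nat.decreasingInduction with
    | self => exact le_rfl
    | of_succ k hk ih => exact ih.trans (hanti k hk)
  have hle0 : ∀ k ≤ N, g k ≤ g 0 := by
    intro k hk
    induction k with
    | zero => exact le_rfl
    | succ k ih => exact (hanti k hk).trans (ih (by omega))
  -- The shift keeps G positive up to k = N, where it equals εR/4. It costs only a factor 2 in G ≤
  -- 2Rh because h ≥ ε/4.
  set G : ℕ → ℝ := fun k => g k - g N + ε * R / 4 with hG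
  have hpos : ∀ k ≤ N, 0 < G k := fun k hk => by
    have := hge k hk
    have : 0 < ε * R := by positivity
    simp only [hG]; linarith
  have hstep : ∀ k < N, 1 / (1152 * R ^ 2) ≤ 1 / G (k + 1) - 1 / G k := by
    intro k hk
    have p0 := hpos k hk.le
    have p1 := hpos (k + 1) hk
    have q1 : G (k + 1) ≤ 2 * R * h (k + 1) := by
      have := hgap k hk
      have := mul_le_mul_of_nonneg_left (hh k hk) hR0.le
      simp only [hG]; linarith
    have q2 : G (k + 1) ^ 2 ≤ 576 * R ^ 2 * (G k - G (k + 1)) := by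
      have e1 : G (k + 1) ^ 2 ≤ (2 * R * h (k + 1)) ^ 2 := by gcongr
      have e2 := mul_le_mul_of_nonneg_left (hg k hk) (by positivity : 0 ≤ 576 * R ^ 2)
      have e3 : G k - G (k + 1) = g k - g (k + 1) := by simp only [hG]; ring
      rw [e3]; nlinarith
    have q3 : G k ≤ 5 / 4 * R := by
      have := hle0 k hk.le
      have : ε * R ≤ 1 * R := by gcongr
      simp only [hG]; linarith
    generalize G k = a at *
    generalize G (k + 1) = b at *
    have e : 1 / b - 1 / a = (a - b) / (a * b) := by field_simp
    rw [e, div_le_div_iff₀ (by positivity) (by positivity)]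
    -- If b ≥ a/2, then b² may be traded for ab/2. Otherwise a - b ≥ b, so 1/b - 1/a ≥ 1/a, and a ≤
    -- 5R/4 with R ≥ 1/2 suffices.
    rcases le_or_gt (a / 2) b with hc | hc
    · nlinarith
    · have t1 : a * b ≤ 5 / 4 * R * b := by gcongr
      have t2 : R * b ≤ R * (a - b) := by gcongr; linarith
      have t3 : 1 / 2 * R * (a - b) ≤ R * R * (a - b) := by
        have : 0 ≤ a - b := by linarith
        gcongr
      nlinarith
  have hsum : ∀ k ≤ N, k * (1 / (1152 * R ^ 2)) ≤ 1 / G k - 1 / G 0 := by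
    intro k hk
    induction k with
    | zero => simp
    | succ k ih =>
      have := ih (by omega)
      have := hstep k hk
      push_cast; linarith
  have hfin := hsum N le_rfl
  have hN : 1 / G N = 4 / (ε * R) := by simp only [hG]; field_simp; ring
  have h0' : 0 < 1 / G 0 := one_div_pos.2 (hpos 0 (Nat.zero_le _))
  rw [hN] at hfin
  have : N * (1 / (1152 * R ^ 2)) ≤ 4 / (ε * R) := by linarith
  rw [mul_one_div, div_le_div_iff₀ (by positivity) (by positivity)] at this
  rw [le_div_iff₀ hε]
  have : N * ε * R ≤ 4608 * R * R := by nlinarith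
  exact le_of_mul_le_mul_right this hR0

theorem minInvDiam_of_top {A : Matrix (Fin n) (Fin n) ℝ} {ε : ℝ} (hε : 0 < ε)
    (hd : diam A = ⊤) : minInvDiam A ε = 1 / ε := by
  simp only [minInvDiam, hd, ENat.toENNReal_top, min_top_right]
  exact ENNReal.toReal_ofReal (by positivity)

theorem minInvDiam_of_coe {A : Matrix (Fin n) (Fin n) ℝ} {ε : ℝ} (hε : 0 < ε) {d : ℕ}
    (hd : diam A = d) : minInvDiam A ε = min (1 / ε) d := by
  simp only [minInvDiam, hd, ENat.toENNReal_coe]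
  rw [ENNReal.toReal_min ENNReal.ofReal_ne_top (ENNReal.natCast_ne_top _),
    ENNReal.toReal_ofReal (by positivity), ENNReal.toReal_natCast]

theorem one_le_minInvDiam (hn : 2 ≤ n) (A : Matrix (Fin n) (Fin n) ℝ) {ε : ℝ} (hε : 0 < ε)
    (hε1 : ε < 1) : 1 ≤ minInvDiam A ε := by
  have h1 : 1 ≤ 1 / ε := by rw [le_div_iff₀ hε]; linarith
  rcases h : diam A with _ | d
  · rw [minInvDiam_of_top hε h]; exact h1
  · rw [minInvDiam_of_coe hε h]
    have h' : diam A = (d : ℕ∞) := h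
    have := one_le_diam hn A
    rw [h'] at this
    refine le_min h1 ?_
    exact_mod_cast this

theorem minInvDiam_le (A : Matrix (Fin n) (Fin n) ℝ) {ε : ℝ} (hε : 0 < ε) :
    minInvDiam A ε ≤ 1 / ε := by
  rcases h : diam A with _ | d
  · rw [minInvDiam_of_top hε h]
  · rw [minInvDiam_of_coe hε h]
    exact min_le_left _ _

/-- The number of cycles of the inexact iteration with large imbalance. -/
theorem IsInexactOsborne.card_cycles_le {A B : Matrix (Fin n) (Fin n) ℝ} (hn : 2 ≤ n)
    (hB : IsAdmissible B) (hAB : ∀ i j, A i j ≠ 0 → 0 < B i j)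
    (h1 : ∀ i j, 0 < B i j → 1 ≤ B i j) {κ : ℝ} (hκ : 2 ≤ κ) (hBκ : total B ≤ κ) {ε δ : ℝ}
    (hε : 0 < ε) (hε1 : ε < 1) (hδ0 : 0 ≤ δ) (hδ : δ ≤ ε / 1152) {σ : ℕ → Equiv.Perm (Fin n)}
    {N : ℕ} {v : ℕ → ℕ → Fin n → ℝ} (hv : IsInexactOsborne B σ δ N v)
    (him : ∀ k < N, ε / 4 ≤ imbalance (expScaled B (v (k + 1) 0))) :
    (N : ℝ) ≤ 9216 * (Real.log κ / ε * minInvDiam A ε) := by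
  have hn0 : 0 < n := by omega
  set g : ℕ → ℝ := fun k => potential B (v k 0) with hg
  set h : ℕ → ℝ := fun k => imbalance (expScaled B (v k 0)) with hh
  have hdec : ∀ k < N, h (k + 1) ^ 2 / 144 ≤ g k - g (k + 1) := by
    intro k hk
    have := him k hk
    simp only [hh, hg]
    rw [hv.next k hk] at this ⊢
    exact potential_cycle_decrease hB hn0 hδ0 (by linarith) (σ k) (v k) (hv.step k hk)
      (by linarith)
  have hlog : Real.log 2 ≤ Real.log κ := Real.log_le_log (by norm_num) hκ
  have hl2 := Real.log_two_gt_d9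
  have hg0 : g 0 ≤ Real.log κ := by
    simp only [hg, potential, hv.init]
    have : expScaled B 0 = B := by ext i j; simp [expScaled_apply]
    refine Real.log_le_log (hB.total_pos 0 hn0) ?_
    rw [this]; exact hBκ
  have hgN : 0 ≤ g N := potential_nonneg hB hn0 h1 _
  have first : (N : ℝ) ≤ 2304 * Real.log κ / ε ^ 2 := by
    have := card_mul_le_of_decrease hε N hdec him
    rw [le_div_iff₀ (by positivity)]
    nlinarith
  have hlκ : 0 < Real.log κ := by linarith
  have bound1 : (N : ℝ) ≤ 9216 * (Real.log κ / ε * (1 / ε)) := by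
    refine first.trans ?_
    have : 9216 * (Real.log κ / ε * (1 / ε)) = 9216 * Real.log κ / ε ^ 2 := by field_simp
    rw [this]
    gcongr
    norm_num
  rcases hd : diam A with _ | d
  · rw [minInvDiam_of_top hε hd]
    exact bound1
  · have hd' : diam A = (d : ℕ∞) := hd
    rw [minInvDiam_of_coe hε hd']
    rcases min_choice (1 / ε) (d : ℝ) with hm | hm
    · rw [hm]; exact bound1
    · rw [hm]
      have hd1 : (1 : ℝ) ≤ d := by
        have := one_le_diam hn A
        rw [hd'] at this
        exact_mod_cast this
      have hle : ∀ k ≤ N, g k ≤ Real.log κ := by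
        intro k hk
        induction k with
        | zero => exact hg0
        | succ k ih =>
          have := hdec k hk
          have := ih (by omega)
          have := sq_nonneg (h (k + 1))
          linarith
      have hosc : ∀ k ≤ N, ∀ i j, |v k 0 i - v k 0 j| ≤ d * Real.log κ := by
        intro k hk
        have : ∀ i j, v k 0 i - v k 0 j ≤ d * Real.log κ := by
          intro i j
          obtain ⟨l, hl, hw⟩ := exists_walk_of_diam_eq hd' i j
          refine (sub_le_of_walk (fun a b hab =>
            sub_le_of_potential_le hB hn0 h1 (hle k hk) (hAB a b hab)) l hw).trans ?_
          gcongr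
        intro i j
        rw [abs_le]
        constructor
        · have := this j i; linarith
        · exact this i j
      -- Each of two iterates oscillates by at most d log κ, so their difference oscillates by at
      -- most R = 2(d log κ). As d ≥ 1, this R also dominates the initial potential and 1/2.
      have hR : Real.log κ ≤ 2 * (d * Real.log κ) := by nlinarith
      have := card_le_of_decrease_of_gap_le (R := 2 * (d * Real.log κ)) hε hε1
        (by linarith) N hdec him (by linarith) (fun k hk =>
          potential_sub_le hB hn0 _ _ fun i j => by
            have a1 := hosc (k + 1) hk i j
            have a2 := hosc N le_rfl i j
            have : v (k + 1) 0 i - v N 0 i - (v (k + 1) 0 j - v N 0 j)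
                = (v (k + 1) 0 i - v (k + 1) 0 j) - (v N 0 i - v N 0 j) := by ring
            rw [this]
            refine (abs_sub _ _).trans ?_
            linarith)
      calc (N : ℝ) ≤ _ := this
        _ = _ := by ring

/-! ### The size of the iterates -/

/-- The old value u_j cancels, leaving ½ log ∑ B_ij exp(u_i) - ½ log ∑ B_ji exp(-u_i). Both
logarithms lie in [-U, log κ + U], so one update adds only ½ log κ to the sup norm. -/
theorem abs_exactUpdate_le {B : Matrix (Fin n) (Fin n) ℝ} (hB : IsAdmissible B)
    (h1 : ∀ i j, 0 < B i j → 1 ≤ B i j) {κ : ℝ} (hBκ : total B ≤ κ) {u : Fin n → ℝ} {U : ℝ}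
    (hu : ∀ i, |u i| ≤ U) (j : Fin n) : |exactUpdate B u j| ≤ U + 1 / 2 * Real.log κ := by
  have up : ∀ f : Fin n → ℝ, (∀ i, 0 ≤ f i) → ∀ e : Fin n → ℝ, (∀ i, e i ≤ U) →
      ∑ i, f i ≤ κ → ∑ i, f i * Real.exp (e i) ≤ κ * Real.exp U := by
    intro f hf e he hs
    calc ∑ i, f i * Real.exp (e i) ≤ ∑ i, f i * Real.exp U := by
          refine Finset.sum_le_sum fun i _ => ?_
          exact mul_le_mul_of_nonneg_left (Real.exp_le_exp.2 (he i)) (hf i)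
      _ = (∑ i, f i) * Real.exp U := by rw [Finset.sum_mul]
      _ ≤ κ * Real.exp U := by gcongr
  have lo : ∀ f : Fin n → ℝ, (∀ i, 0 ≤ f i) → ∀ e : Fin n → ℝ, (∀ i, -U ≤ e i) →
      (∃ i, 1 ≤ f i) → Real.exp (-U) ≤ ∑ i, f i * Real.exp (e i) := by
    rintro f hf e he ⟨i, hi⟩
    calc Real.exp (-U) ≤ f i * Real.exp (e i) :=
          (Real.exp_le_exp.2 (he i)).trans (le_mul_of_one_le_left (Real.exp_pos _).le hi)
      _ ≤ _ := Finset.single_le_sum (f := fun i => f i * Real.exp (e i))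
          (fun i _ => mul_nonneg (hf i) (Real.exp_pos _).le) (Finset.mem_univ i)
  have hrow : rowSum (expScaled B u) j
      = Real.exp (u j) * ∑ i, B j i * Real.exp (-(u i)) := by
    rw [Finset.mul_sum]
    refine Finset.sum_congr rfl fun i _ => ?_
    rw [expScaled_apply, sub_eq_add_neg, Real.exp_add]; ring
  have hcol : colSum (expScaled B u) j
      = Real.exp (-(u j)) * ∑ i, B i j * Real.exp (u i) := by
    rw [Finset.mul_sum]
    refine Finset.sum_congr rfl fun i _ => ?_
    rw [expScaled_apply, sub_eq_add_neg, Real.exp_add]; ring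
  have b1 : ∑ i, B j i ≤ κ := by
    refine le_trans ?_ hBκ
    rw [total_eq_sum_rowSum]
    exact Finset.single_le_sum (f := fun i => rowSum B i)
      (fun i _ => Finset.sum_nonneg fun _ _ => hB.nonneg _ _) (Finset.mem_univ j)
  have b2 : ∑ i, B i j ≤ κ := by
    refine le_trans ?_ hBκ
    rw [total_eq_sum_colSum]
    exact Finset.single_le_sum (f := fun i => colSum B i)
      (fun i _ => Finset.sum_nonneg fun _ _ => hB.nonneg _ _) (Finset.mem_univ j)
  obtain ⟨ir, hir⟩ := hB.row j
  obtain ⟨ic, hic⟩ := hB.col j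
  have r1 := up (fun i => B j i) (fun i => hB.nonneg _ _) (fun i => -(u i))
    (fun i => by have := (abs_le.1 (hu i)).1; linarith) b1
  have r2 := lo (fun i => B j i) (fun i => hB.nonneg _ _) (fun i => -(u i))
    (fun i => by have := (abs_le.1 (hu i)).2; linarith) ⟨ir, h1 _ _ hir⟩
  have c1 := up (fun i => B i j) (fun i => hB.nonneg _ _) u (fun i => (abs_le.1 (hu i)).2) b2
  have c2 := lo (fun i => B i j) (fun i => hB.nonneg _ _) u (fun i => (abs_le.1 (hu i)).1)
    ⟨ic, h1 _ _ hic⟩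
  have hκ : 0 < κ := by
    have : 1 ≤ B j ir := h1 _ _ hir
    have : B j ir ≤ ∑ i, B j i :=
      Finset.single_le_sum (f := fun i => B j i) (fun i _ => hB.nonneg _ _) (Finset.mem_univ ir)
    linarith
  have logs : ∀ s : ℝ, Real.exp (-U) ≤ s → s ≤ κ * Real.exp U →
      -U ≤ Real.log s ∧ Real.log s ≤ Real.log κ + U := by
    intro s s1 s2
    have hs : 0 < s := (Real.exp_pos _).trans_le s1
    constructor
    · rwa [Real.le_log_iff_exp_le hs]
    · rw [Real.log_le_iff_le_exp hs, Real.exp_add, Real.exp_log hκ]; exact s2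
  obtain ⟨r3, r4⟩ := logs _ r2 r1
  obtain ⟨c3, c4⟩ := logs _ c2 c1
  have hx : exactUpdate B u j = 1 / 2 * Real.log (∑ i, B i j * Real.exp (u i))
      - 1 / 2 * Real.log (∑ i, B j i * Real.exp (-(u i))) := by
    show u j + 1 / 2 * Real.log (colSum (expScaled B u) j)
      - 1 / 2 * Real.log (rowSum (expScaled B u) j) = _
    rw [hrow, hcol, Real.log_mul (Real.exp_pos _).ne' ((Real.exp_pos _).trans_le r2).ne',
      Real.log_mul (Real.exp_pos _).ne' ((Real.exp_pos _).trans_le c2).ne', Real.log_exp,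
      Real.log_exp]
    ring
  rw [hx, abs_le]
  constructor <;> linarith

/-! ### Specifications of runs -/

/-- From every count of operations, the run succeeds after at most `c` further operations with a
result that satisfies `Q`. -/
def RunsWithin {α : Type} (m : Run α) (c : ℕ) (Q : α → Prop) : Prop :=
  ∀ t, ∃ a c', m.run t = some (a, t + c') ∧ c' ≤ c ∧ Q a

namespace RunsWithin

variable {α β : Type}

theorem pure {a : α} {Q : α → Prop} (h : Q a) : RunsWithin (pure a) 0 Q :=
  fun _ => ⟨a, 0, rfl, le_rfl, h⟩

theorem bind {m : Run α} {f : α → Run β} {c₁ c₂ : ℕ} {Q : α → Prop} {R : β → Prop}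
    (hm : RunsWithin m c₁ Q) (hf : ∀ a, Q a → RunsWithin (f a) c₂ R) :
    RunsWithin (m >>= f) (c₁ + c₂) R := by
  intro t
  obtain ⟨a, c, h1, h2, h3⟩ := hm t
  obtain ⟨b, c', h4, h5, h6⟩ := hf a h3 (t + c)
  refine ⟨b, c + c', ?_, by omega, h6⟩
  rw [StateT.run_bind, h1]
  rw [← add_assoc, ← h4]
  rfl

theorem mono {m : Run α} {c c' : ℕ} {Q R : α → Prop} (hm : RunsWithin m c Q) (hc : c ≤ c')
    (h : ∀ a, Q a → R a) : RunsWithin m c' R := by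
  intro t
  obtain ⟨a, k, h1, h2, h3⟩ := hm t
  exact ⟨a, k, h1, h2.trans hc, h a h3⟩

theorem mapM {f : α → Run β} {g : α → β} {c : ℕ} (l : List α)
    (h : ∀ x ∈ l, RunsWithin (f x) c (· = g x)) :
    RunsWithin (l.mapM f) (l.length * c) (· = l.map g) := by
  induction l with
  | nil => exact (RunsWithin.pure (Q := (· = ([] : List β))) rfl).mono (Nat.zero_le _) fun _ h => h
  | cons x l ih =>
    rw [List.mapM_cons]
    have := ih fun y hy => h y (List.mem_cons_of_mem _ hy)
    refine ((h x List.mem_cons_self).bind fun b hb => this.bind fun bs hbs =>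
      RunsWithin.pure (Q := (· = (x :: l).map g)) (by simp [hb, hbs])).mono ?_ fun _ h => h
    simp [add_mul, add_comm]

/-- An invariant that may depend on the remaining list. -/
theorem foldlM {f : β → α → Run β} (I : List α → β → Prop) (cost : α → ℕ) (l : List α) {b : β}
    (hb : I l b) (h : ∀ x xs b, (x :: xs) <:+ l → I (x :: xs) b →
      RunsWithin (f b x) (cost x) (I xs)) :
    RunsWithin (l.foldlM f b) (l.map cost).sum (I []) := by
  induction l generalizing b with
  | nil => exact RunsWithin.pure hb
  | cons x l ih =>
    rw [List.foldlM_cons, List.map_cons, List.sum_cons]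
    exact (h x l b (List.suffix_refl _) hb).bind fun b' hb' =>
      ih hb' fun y ys b'' hs => h y ys b'' (hs.trans (List.suffix_cons _ _))

/-- A fold whose steps satisfy a relation, together with the sequence of its states. -/
theorem foldlM_states {f : β → α → Run β} (I : ℕ → β → Prop) (R : α → β → β → Prop)
    (cost : α → ℕ) (l : List α) (i₀ : ℕ) {b : β} (hb : I i₀ b)
    (h : ∀ x ∈ l, ∀ i b, i < i₀ + l.length → I i b →
      RunsWithin (f b x) (cost x) fun b' => I (i + 1) b' ∧ R x b b') :
    RunsWithin (l.foldlM f b) (l.map cost).sum fun b' => I (i₀ + l.length) b' ∧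
      ∃ s : ℕ → β, s 0 = b ∧ s l.length = b' ∧
        ∀ i (hi : i < l.length), R l[i] (s i) (s (i + 1)) := by
  induction l generalizing b i₀ with
  | nil => exact RunsWithin.pure ⟨hb, fun _ => b, rfl, rfl, by simp⟩
  | cons x l ih =>
    rw [List.foldlM_cons, List.map_cons, List.sum_cons]
    refine (h x List.mem_cons_self i₀ b (by simp) hb).bind fun b' hb' => ?_
    refine (ih (i₀ + 1) hb'.1 fun y hy i b'' hi => ?_).mono le_rfl ?_
    · exact h y (List.mem_cons_of_mem _ hy) i b'' (by simp only [List.length_cons]; omega)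
    · rintro b'' ⟨hI, s, h0, hl, hR⟩
      refine ⟨by simpa [add_assoc, add_comm 1] using hI, fun k => Nat.casesOn k b s, rfl, hl, ?_⟩
      rintro (_ | i) hi
      · simpa [h0] using hb'.2
      · simpa using hR i (by simpa using hi)

end RunsWithin

/-! ### Words -/

/-- The unit in the last place. -/
noncomputable def ulp (p : ℕ) : ℝ := (2 ^ p)⁻¹

theorem ulp_pos (p : ℕ) : 0 < ulp p := by unfold ulp; positivity

theorem ulp_le_one (p : ℕ) : ulp p ≤ 1 := by
  unfold ulp; exact inv_le_one_of_one_le₀ (one_le_pow₀ (by norm_num))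

theorem val_zero (p : ℕ) : val p 0 = 0 := by simp [val]

theorem val_add (p : ℕ) (x y : ℤ) : val p (x + y) = val p x + val p y := by
  simp [val, add_div]

theorem val_sub (p : ℕ) (x y : ℤ) : val p (x - y) = val p x - val p y := by
  simp [val, sub_div]

theorem val_abs (p : ℕ) (x : ℤ) : val p |x| = |val p x| := by
  simp [val, abs_div]

theorem val_le_val {p : ℕ} {x y : ℤ} : val p x ≤ val p y ↔ x ≤ y := by
  unfold val
  rw [div_le_div_iff_of_pos_right (by positivity), Int.cast_le]

theorem val_list_sum (p : ℕ) (l : List ℤ) : val p l.sum = (l.map (val p)).sum := by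
  induction l with
  | nil => simp [val_zero]
  | cons x l ih => simp [val_add, ih]

theorem val_two_pow (p : ℕ) : val p (2 ^ p) = 1 := by
  simp [val]

theorem val_floor_le (p : ℕ) (y : ℝ) : val p ⌊y * 2 ^ p⌋ ≤ y := by
  unfold val
  rw [div_le_iff₀ (by positivity)]
  exact Int.floor_le _

theorem sub_ulp_le_val_floor (p : ℕ) (y : ℝ) : y - ulp p ≤ val p ⌊y * 2 ^ p⌋ := by
  unfold val ulp
  rw [le_div_iff₀ (by positivity), sub_mul, inv_mul_cancel₀ (by positivity)]
  exact (Int.sub_one_lt_floor _).le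

theorem abs_val_floor_le (p : ℕ) (y : ℝ) : |val p ⌊y * 2 ^ p⌋| ≤ |y| + 1 := by
  have h1 := val_floor_le p y
  have h2 := sub_ulp_le_val_floor p y
  have h3 := ulp_le_one p
  have h4 := abs_le.1 (le_refl |y|)
  rw [abs_le]; constructor <;> linarith

theorem runsWithin_emit {p : ℕ} {w : ℤ} (h : |val p w| < 2 ^ p) :
    RunsWithin (emit p w) 1 (· = w) := by
  intro t
  refine ⟨w, 1, ?_, le_rfl, rfl⟩
  have : |w| < 2 ^ (2 * p) := by
    rw [← val_abs, val, div_lt_iff₀ (by positivity), ← pow_add, ← two_mul] at h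
    exact_mod_cast h
  exact if_pos this

theorem runsWithin_emit_floor {p : ℕ} {y : ℝ} (h : |y| + 1 < 2 ^ p) :
    RunsWithin (emit p ⌊y * 2 ^ p⌋) 1 (· = ⌊y * 2 ^ p⌋) :=
  runsWithin_emit ((abs_val_floor_le p y).trans_lt h)

theorem runsWithin_vlog {p : ℕ} {x : ℤ} (hx : 0 < x) (h : |Real.log (val p x)| + 1 < 2 ^ p) :
    RunsWithin (vlog p x) 1 (· = ⌊Real.log (val p x) * 2 ^ p⌋) := by
  unfold vlog
  rw [if_pos hx]
  exact runsWithin_emit_floor h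

/-- The result of truncating a word. -/
theorem val_trunc {p q : ℕ} (hq : q ≤ p) (x : ℤ) :
    val p (2 ^ (p - q) * (x / 2 ^ (p - q))) ≤ val p x ∧
      val p x - 1 / 2 ^ q ≤ val p (2 ^ (p - q) * (x / 2 ^ (p - q))) := by
  have hpos : (0 : ℤ) < 2 ^ (p - q) := by positivity
  have h1 := Int.emod_add_mul_ediv x (2 ^ (p - q))
  have h2 := Int.emod_nonneg x hpos.ne'
  have h3 := Int.emod_lt_of_pos x hpos
  constructor
  · rw [val_le_val]; linarith
  · have h4 : val p x = val p (x % 2 ^ (p - q)) + val p (2 ^ (p - q) * (x / 2 ^ (p - q))) := by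
      rw [← val_add, h1]
    have h5 : val p (x % 2 ^ (p - q)) ≤ val p (2 ^ (p - q)) := val_le_val.2 h3.le
    have h6 : val p (2 ^ (p - q)) = 1 / 2 ^ q := by
      unfold val
      push_cast
      rw [div_eq_div_iff (by positivity) (by positivity), one_mul, ← pow_add]
      congr 1; omega
    linarith

theorem runsWithin_truncTo {p q : ℕ} (hq : q ≤ p) {x : ℤ} (h : |val p x| + 1 < 2 ^ p) :
    RunsWithin (truncTo p q x) 1 fun y =>
      val p y ≤ val p x ∧ val p x - 1 / 2 ^ q ≤ val p y ∧ (0 ≤ x → 0 ≤ y) := by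
  obtain ⟨h1, h2⟩ := val_trunc hq x
  have h3 : (1 : ℝ) / 2 ^ q ≤ 1 := by
    rw [div_le_one (by positivity)]; exact one_le_pow₀ (by norm_num)
  refine (runsWithin_emit ?_).mono le_rfl fun y hy => by
    rw [hy]; exact ⟨h1, h2, fun h => mul_nonneg (by positivity) (Int.ediv_nonneg h (by positivity))⟩
  refine lt_of_le_of_lt ?_ h
  have h4 := abs_le.1 (le_refl |val p x|)
  rw [abs_le]; constructor <;> linarith

theorem runsWithin_vle (x y : ℤ) : RunsWithin (vle x y) 1 (· = decide (x ≤ y)) :=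
  fun _ => ⟨_, 1, rfl, le_rfl, rfl⟩

/-! ### Log-sum-exp -/

theorem runsWithin_listMax {p : ℕ} {zs : List ℤ} (hne : zs ≠ [])
    (h : ∀ z ∈ zs, |val p z| < 2 ^ p) :
    RunsWithin (listMax p zs) zs.length fun M => M ∈ zs ∧ ∀ z ∈ zs, z ≤ M := by
  obtain ⟨z, zs, rfl⟩ := List.exists_cons_of_ne_nil hne
  unfold listMax
  have := RunsWithin.foldlM (f := vmax p)
    (fun rem M => M ∈ z :: zs ∧ ∀ y ∈ z :: zs, y ≤ M ∨ y ∈ rem) (fun _ => 1) zs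
    (b := z) ⟨List.mem_cons_self, fun y hy => by
      rcases List.mem_cons.1 hy with rfl | hy
      · exact Or.inl le_rfl
      · exact Or.inr hy⟩ (by
      rintro x xs M hs ⟨hM, hy⟩
      have hx : x ∈ z :: zs := List.mem_cons_of_mem _ (hs.subset List.mem_cons_self)
      have hmem : max M x ∈ z :: zs := by
        rcases max_choice M x with e | e <;> rw [e] <;> assumption
      refine (runsWithin_emit (h _ hmem)).mono le_rfl ?_
      rintro _ rfl
      refine ⟨hmem, fun y hyz => ?_⟩
      rcases hy y hyz with h1 | h1
      · exact Or.inl (h1.trans (le_max_left _ _))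
      · rcases List.mem_cons.1 h1 with rfl | h1
        · exact Or.inl (le_max_right _ _)
        · exact Or.inr h1)
  refine this.mono (by simp) fun M hM => ⟨hM.1, fun y hy => ?_⟩
  rcases hM.2 y hy with h1 | h1
  · exact h1
  · cases h1

/-- The word computed by `sumExp`. -/
noncomputable def sumExpWord (p : ℕ) (M : ℤ) (zs : List ℤ) : ℤ :=
  (zs.map fun z => ⌊Real.exp (val p (z - M)) * 2 ^ p⌋).sum

theorem sumExpWord_nonneg (p : ℕ) (M : ℤ) (zs : List ℤ) : 0 ≤ sumExpWord p M zs := by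
  refine List.sum_nonneg fun x hx => ?_
  obtain ⟨z, -, rfl⟩ := List.mem_map.1 hx
  exact Int.floor_nonneg.2 (by positivity)

theorem val_sumExpWord_le (p : ℕ) (M : ℤ) (zs : List ℤ) :
    val p (sumExpWord p M zs) ≤ (zs.map fun z => Real.exp (val p (z - M))).sum := by
  unfold sumExpWord
  rw [val_list_sum, List.map_map]
  exact List.sum_le_sum fun z _ => val_floor_le _ _

theorem le_val_sumExpWord (p : ℕ) (M : ℤ) (zs : List ℤ) :
    (zs.map fun z => Real.exp (val p (z - M))).sum - zs.length * ulp p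
      ≤ val p (sumExpWord p M zs) := by
  unfold sumExpWord
  induction zs with
  | nil => simp [val_zero]
  | cons z zs ih =>
    have := sub_ulp_le_val_floor p (Real.exp (val p (z - M)))
    simp only [List.map_cons, List.sum_cons, val_add, List.length_cons]
    push_cast
    linarith

theorem val_sumExpWord_le_length {p : ℕ} {M : ℤ} {zs : List ℤ} (h : ∀ z ∈ zs, z ≤ M) :
    val p (sumExpWord p M zs) ≤ zs.length := by
  refine (val_sumExpWord_le p M zs).trans ?_
  have := List.sum_le_card_nsmul (zs.map fun z => Real.exp (val p (z - M))) 1 (by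
    intro x hx
    obtain ⟨z, hz, rfl⟩ := List.mem_map.1 hx
    rw [Real.exp_le_one_iff, ← val_zero p, val_le_val]
    have := h z hz
    omega)
  simpa using this

theorem runsWithin_sumExp {p : ℕ} {M : ℤ} {zs : List ℤ} (h : ∀ z ∈ zs, z ≤ M)
    (hd : ∀ z ∈ zs, |val p (z - M)| < 2 ^ p) (hl : (zs.length : ℝ) + 2 < 2 ^ p) :
    RunsWithin (sumExp p M zs) (3 * zs.length) (· = sumExpWord p M zs) := by
  have := RunsWithin.foldlM (f := fun s z => do
      let x ← sub p z M
      let y ← vexp p x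
      add p s y)
    -- All terms are nonnegative, so bounding the final sum rules out overflow of every partial sum.
    (fun rem s => 0 ≤ s ∧ s + sumExpWord p M rem = sumExpWord p M zs) (fun _ => 3) zs
    (b := 0) ⟨le_rfl, by simp⟩ (by
      rintro z rem s hs ⟨h0, hsum⟩
      have hz : z ∈ zs := hs.subset List.mem_cons_self
      have he : Real.exp (val p (z - M)) ≤ 1 := by
        rw [Real.exp_le_one_iff, ← val_zero p, val_le_val]
        have := h z hz
        omega
      have hlen : (1 : ℝ) ≤ zs.length := by
        exact_mod_cast List.length_pos_of_mem hz
      have e1 : sumExpWord p M (z :: rem)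
          = ⌊Real.exp (val p (z - M)) * 2 ^ p⌋ + sumExpWord p M rem := by
        simp [sumExpWord]
      have f0 : 0 ≤ ⌊Real.exp (val p (z - M)) * 2 ^ p⌋ := Int.floor_nonneg.2 (by positivity)
      have r0 := sumExpWord_nonneg p M rem
      refine ((runsWithin_emit (hd z hz)).bind (c₂ := 2) ?_).mono (by simp) fun _ h => h
      rintro _ rfl
      refine ((runsWithin_emit_floor (y := Real.exp (val p (z - M))) ?_).bind (c₂ := 1) ?_).mono
        (by simp) fun _ h => h
      · rw [abs_of_pos (Real.exp_pos _)]; linarith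
      rintro _ rfl
      refine (runsWithin_emit ?_).mono le_rfl ?_
      · have a1 : 0 ≤ s + ⌊Real.exp (val p (z - M)) * 2 ^ p⌋ := by omega
        have a2 : s + ⌊Real.exp (val p (z - M)) * 2 ^ p⌋ ≤ sumExpWord p M zs := by omega
        rw [← val_le_val (p := p), val_zero] at a1
        rw [← val_le_val (p := p)] at a2
        rw [abs_of_nonneg a1]
        have := val_sumExpWord_le_length (p := p) h
        linarith
      · rintro _ rfl
        exact ⟨by omega, by omega⟩)
  refine this.mono (by simp [mul_comm]) fun s hs => ?_
  have : sumExpWord p M [] = 0 := by simp [sumExpWord]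
  have := hs.2
  omega

theorem sum_exp_sub (p : ℕ) (M : ℤ) (zs : List ℤ) :
    (zs.map fun z => Real.exp (val p (z - M))).sum
      = Real.exp (-val p M) * (zs.map fun z => Real.exp (val p z)).sum := by
  rw [← List.sum_map_mul_left]
  congr 1
  refine List.map_congr_left fun z _ => ?_
  rw [← Real.exp_add, val_sub]; ring_nf

/-- The term of the maximum is exp(0) = 1, which is a word and is not rounded. Hence later absolute
errors are also relative errors. -/
theorem one_le_val_sumExpWord {p : ℕ} {M : ℤ} {zs : List ℤ} (h : M ∈ zs) :
    1 ≤ val p (sumExpWord p M zs) := by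
  rw [← val_two_pow p, val_le_val]
  unfold sumExpWord
  refine List.single_le_sum ?_ _ (List.mem_map.2 ⟨M, h, ?_⟩)
  · intro x hx
    obtain ⟨z, -, rfl⟩ := List.mem_map.1 hx
    exact Int.floor_nonneg.2 (by positivity)
  · simp only [sub_self, val_zero, Real.exp_zero, one_mul]
    exact_mod_cast Int.floor_intCast (R := ℝ) (2 ^ p)

/-- After subtracting the maximum the sum lies between 1 and its length, where the logarithm does
not amplify errors. Each exponential and the logarithm lose at most one unit in the last place,
always downwards. -/
theorem runsWithin_logSumExp {p : ℕ} {zs : List ℤ} {Z : ℝ} (hne : zs ≠ [])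
    (h : ∀ z ∈ zs, |val p z| ≤ Z) (hZ : 2 * Z + zs.length + 2 < 2 ^ p) :
    RunsWithin (logSumExp p zs) (4 * zs.length + 2) fun l =>
      val p l ≤ Real.log (zs.map fun z => Real.exp (val p z)).sum ∧
      Real.log (zs.map fun z => Real.exp (val p z)).sum - (zs.length + 1) * ulp p ≤ val p l ∧
      |val p l| ≤ Z + zs.length + 1 := by
  have hZ0 : 0 ≤ Z := by
    obtain ⟨z, hz⟩ := List.exists_mem_of_ne_nil _ hne
    exact (abs_nonneg _).trans (h z hz)
  have hlen0 : (0 : ℝ) ≤ zs.length := by positivity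
  unfold logSumExp
  refine ((runsWithin_listMax hne fun z hz => (h z hz).trans_lt (by linarith)).bind
    (c₂ := 3 * zs.length + 2) ?_).mono (by omega) fun _ h => h
  rintro M ⟨hM, hmax⟩
  refine (runsWithin_sumExp hmax (fun z hz => ?_) (by linarith)).bind ?_
  · rw [val_sub]
    have := h z hz
    have := h M hM
    have := abs_sub (val p z) (val p M)
    linarith
  rintro _ rfl
  set s := sumExpWord p M zs with hs
  have s1 : 1 ≤ val p s := one_le_val_sumExpWord hM
  have s2 : val p s ≤ zs.length := val_sumExpWord_le_length hmax
  have s3 := val_sumExpWord_le p M zs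
  have s4 := le_val_sumExpWord p M zs
  rw [← hs] at s3 s4
  have hspos : 0 < s := by
    by_contra hc
    have : val p s ≤ val p 0 := val_le_val.2 (by omega)
    rw [val_zero] at this; linarith
  have hsum : 0 < (zs.map fun z => Real.exp (val p z)).sum := by
    refine List.sum_pos _ (fun x hx => ?_) (by simpa using hne)
    obtain ⟨z, -, rfl⟩ := List.mem_map.1 hx
    positivity
  have hE := sum_exp_sub p M zs
  set E := (zs.map fun z => Real.exp (val p (z - M))).sum with hEdef
  have hElog : Real.log E
      = Real.log (zs.map fun z => Real.exp (val p z)).sum - val p M := by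
    rw [hE, Real.log_mul (Real.exp_pos _).ne' hsum.ne', Real.log_exp]; ring
  have l1 : Real.log (val p s) ≤ Real.log E := Real.log_le_log (by linarith) s3
  have l2 : Real.log E - zs.length * ulp p ≤ Real.log (val p s) := by
    have hE0 : 0 < E := by linarith
    have hs0 : 0 < val p s := by linarith
    have := Real.log_le_sub_one_of_pos (div_pos hE0 hs0)
    rw [Real.log_div hE0.ne' hs0.ne'] at this
    have : E / val p s - 1 ≤ zs.length * ulp p := by
      rw [div_sub_one hs0.ne', div_le_iff₀ hs0]
      have : 0 ≤ zs.length * ulp p := mul_nonneg hlen0 (ulp_pos p).le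
      nlinarith
    linarith
  have l3 : 0 ≤ Real.log (val p s) := Real.log_nonneg s1
  have l4 : Real.log (val p s) ≤ zs.length :=
    (Real.log_le_sub_one_of_pos (by linarith)).trans (by linarith)
  refine (runsWithin_vlog hspos (by rw [abs_of_nonneg l3]; linarith)).bind (c₂ := 1) ?_
  rintro _ rfl
  have f1 := val_floor_le p (Real.log (val p s))
  have f2 := sub_ulp_le_val_floor p (Real.log (val p s))
  have f3 := ulp_le_one p
  have f4 := abs_le.1 (h M hM)
  have hbd : |val p (M + ⌊Real.log (val p s) * 2 ^ p⌋)| ≤ Z + zs.length + 1 := by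
    rw [val_add, abs_le]
    constructor <;> linarith
  refine (runsWithin_emit (hbd.trans_lt (by linarith))).mono le_rfl ?_
  rintro _ rfl
  refine ⟨?_, ?_, hbd⟩ <;> rw [val_add] <;> linarith

/-! ### Sums over supports -/

theorem sum_map_filter_finRange {R : Type*} [AddCommMonoid R] (q : Fin n → Prop) [DecidablePred q]
    (f : Fin n → R) :
    (((List.finRange n).filter fun i => q i).map f).sum = ∑ i, if q i then f i else 0 := by
  rw [Fin.sum_univ_def]
  induction List.finRange n with
  | nil => simp
  | cons x l ih => by_cases h : q x <;> simp [h, ih]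

theorem length_filter_finRange (q : Fin n → Prop) [DecidablePred q] :
    ((List.finRange n).filter fun i => q i).length = ∑ i, if q i then 1 else 0 := by
  rw [← sum_map_filter_finRange q fun _ => 1]
  simp

theorem mem_rowSupport {A : Matrix (Fin n) (Fin n) ℝ} {i j : Fin n} :
    j ∈ rowSupport A i ↔ A i j ≠ 0 := by simp [rowSupport]

theorem mem_colSupport {A : Matrix (Fin n) (Fin n) ℝ} {i j : Fin n} :
    i ∈ colSupport A j ↔ A i j ≠ 0 := by simp [colSupport]

theorem mem_edges {A : Matrix (Fin n) (Fin n) ℝ} {e : Fin n × Fin n} :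
    e ∈ edges A ↔ A e.1 e.2 ≠ 0 := by
  obtain ⟨i, j⟩ := e
  simp [edges, mem_rowSupport]

theorem sum_map_edges {R : Type*} [AddCommMonoid R] (A : Matrix (Fin n) (Fin n) ℝ)
    (f : Fin n × Fin n → R) :
    ((edges A).map f).sum = ∑ i, ((rowSupport A i).map fun j => f (i, j)).sum := by
  unfold edges
  rw [Fin.sum_univ_def]
  induction List.finRange n with
  | nil => simp
  | cons x l ih =>
    simp only [List.flatMap_cons, List.map_append, List.sum_append, List.map_cons, List.sum_cons, ih,
      List.map_map]
    rfl

theorem sum_length_rowSupport (A : Matrix (Fin n) (Fin n) ℝ) :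
    ∑ i, (rowSupport A i).length = nnz A := by
  unfold nnz rowSupport
  rw [Finset.card_filter, Fintype.sum_prod_type]
  exact Finset.sum_congr rfl fun i _ => length_filter_finRange _

theorem sum_length_colSupport (A : Matrix (Fin n) (Fin n) ℝ) :
    ∑ j, (colSupport A j).length = nnz A := by
  unfold nnz colSupport
  rw [Finset.card_filter, Fintype.sum_prod_type, Finset.sum_comm]
  exact Finset.sum_congr rfl fun i _ => length_filter_finRange _

theorem length_edges (A : Matrix (Fin n) (Fin n) ℝ) : (edges A).length = nnz A := by
  have := sum_map_edges A fun _ => 1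
  simp only [List.map_const', List.sum_replicate, smul_eq_mul, mul_one] at this
  rw [this, sum_length_rowSupport]

theorem length_rowSupport_le (A : Matrix (Fin n) (Fin n) ℝ) (i : Fin n) :
    (rowSupport A i).length ≤ n :=
  (List.length_filter_le _ _).trans_eq List.length_finRange

theorem length_colSupport_le (A : Matrix (Fin n) (Fin n) ℝ) (i : Fin n) :
    (colSupport A i).length ≤ n :=
  (List.length_filter_le _ _).trans_eq List.length_finRange

theorem nnz_le (A : Matrix (Fin n) (Fin n) ℝ) : nnz A ≤ n * n := by
  rw [← sum_length_rowSupport]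
  refine (Finset.sum_le_card_nsmul _ _ n fun i _ => length_rowSupport_le A i).trans ?_
  simp

/-! ### The matrix behind the words -/

/-- The matrix with the nonzero positions of `A` and the logarithms `L`. -/
noncomputable def logMatrix (p : ℕ) (A : Matrix (Fin n) (Fin n) ℝ) (L : Fin n × Fin n → ℤ) :
    Matrix (Fin n) (Fin n) ℝ :=
  Matrix.of fun i j => if A i j ≠ 0 then Real.exp (val p (L (i, j))) else 0

/-- The word for the logarithm of an entry of the scaled matrix. -/
def entryWord (L : Fin n × Fin n → ℤ) (u : Fin n → ℤ) (e : Fin n × Fin n) : ℤ :=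
  u e.1 - u e.2 + L e

/-- The vector of real numbers that a vector of words stands for. -/
noncomputable def vals (p : ℕ) (u : Fin n → ℤ) : Fin n → ℝ := fun i => val p (u i)

theorem vals_update (p : ℕ) (u : Fin n → ℤ) (j : Fin n) (x : ℤ) :
    vals p (Function.update u j x) = Function.update (vals p u) j (val p x) := by
  ext i
  by_cases h : i = j
  · subst h; simp [vals]
  · simp [vals, h]

variable {p : ℕ} {A : Matrix (Fin n) (Fin n) ℝ} {L : Fin n × Fin n → ℤ}

theorem expScaled_logMatrix (u : Fin n → ℤ) (i j : Fin n) :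
    expScaled (logMatrix p A L) (vals p u) i j
      = if A i j ≠ 0 then Real.exp (val p (entryWord L u (i, j))) else 0 := by
  rw [expScaled_apply, logMatrix, Matrix.of_apply]
  by_cases h : A i j = 0
  · simp [h]
  · rw [if_pos h, if_pos h, ← Real.exp_add, entryWord, val_add, val_sub, vals, vals]; ring_nf

theorem rowSum_logMatrix (u : Fin n → ℤ) (i : Fin n) :
    rowSum (expScaled (logMatrix p A L) (vals p u)) i
      = ((rowSupport A i).map fun j => Real.exp (val p (entryWord L u (i, j)))).sum := by
  unfold rowSupport
  rw [sum_map_filter_finRange]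
  exact Finset.sum_congr rfl fun j _ => expScaled_logMatrix u i j

theorem colSum_logMatrix (u : Fin n → ℤ) (j : Fin n) :
    colSum (expScaled (logMatrix p A L) (vals p u)) j
      = ((colSupport A j).map fun i => Real.exp (val p (entryWord L u (i, j)))).sum := by
  unfold colSupport
  rw [sum_map_filter_finRange]
  exact Finset.sum_congr rfl fun i _ => expScaled_logMatrix u i j

theorem total_logMatrix (u : Fin n → ℤ) :
    total (expScaled (logMatrix p A L) (vals p u))
      = ((edges A).map fun e => Real.exp (val p (entryWord L u e))).sum := by
  rw [sum_map_edges, total_eq_sum_rowSum]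
  exact Finset.sum_congr rfl fun i _ => rowSum_logMatrix u i

/-- The words of the logarithms are nonnegative and at most `ℓ`. -/
def LogsWithin (p : ℕ) (A : Matrix (Fin n) (Fin n) ℝ) (L : Fin n × Fin n → ℤ) (ℓ : ℝ) : Prop :=
  ∀ i j, A i j ≠ 0 → 0 ≤ val p (L (i, j)) ∧ val p (L (i, j)) ≤ ℓ

theorem abs_val_entryWord_le {ℓ U : ℝ} (hL : LogsWithin p A L ℓ) {u : Fin n → ℤ}
    (hu : ∀ i, |vals p u i| ≤ U) {i j : Fin n} (h : A i j ≠ 0) :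
    |val p (entryWord L u (i, j))| ≤ 2 * U + ℓ := by
  obtain ⟨h1, h2⟩ := hL i j h
  have h3 := abs_le.1 (hu i)
  have h4 := abs_le.1 (hu j)
  simp only [vals] at h3 h4
  simp only [entryWord, val_add, val_sub]
  rw [abs_le]; constructor <;> linarith

theorem runsWithin_logScaled {ℓ U : ℝ} (hL : LogsWithin p A L ℓ) {u : Fin n → ℤ}
    (hu : ∀ i, |vals p u i| ≤ U) (hU : 2 * U + ℓ < 2 ^ p) {i j : Fin n} (h : A i j ≠ 0) :
    RunsWithin (logScaled p L u (i, j)) 2 (· = entryWord L u (i, j)) := by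
  refine ((runsWithin_emit ?_).bind (c₂ := 1) ?_).mono le_rfl fun _ h => h
  · obtain ⟨h1, h2⟩ := hL i j h
    have h3 := abs_le.1 (hu i)
    have h4 := abs_le.1 (hu j)
    simp only [vals] at h3 h4
    rw [val_sub, abs_lt]
    constructor <;> linarith
  · rintro _ rfl
    exact runsWithin_emit ((abs_val_entryWord_le hL hu h).trans_lt hU)

theorem runsWithin_rowLogs {ℓ U : ℝ} (hL : LogsWithin p A L ℓ) {u : Fin n → ℤ}
    (hu : ∀ i, |vals p u i| ≤ U) (hU : 2 * U + ℓ < 2 ^ p) (j : Fin n) :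
    RunsWithin ((rowSupport A j).mapM fun i => logScaled p L u (j, i))
      ((rowSupport A j).length * 2)
      (· = (rowSupport A j).map fun i => entryWord L u (j, i)) :=
  RunsWithin.mapM _ fun _ hi => runsWithin_logScaled hL hu hU (mem_rowSupport.1 hi)

theorem runsWithin_colLogs {ℓ U : ℝ} (hL : LogsWithin p A L ℓ) {u : Fin n → ℤ}
    (hu : ∀ i, |vals p u i| ≤ U) (hU : 2 * U + ℓ < 2 ^ p) (j : Fin n) :
    RunsWithin ((colSupport A j).mapM fun i => logScaled p L u (i, j))
      ((colSupport A j).length * 2)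
      (· = (colSupport A j).map fun i => entryWord L u (i, j)) :=
  RunsWithin.mapM _ fun _ hi => runsWithin_logScaled hL hu hU (mem_colSupport.1 hi)

/-- The number of nonzero entries in row and column `j`. -/
noncomputable def degree (A : Matrix (Fin n) (Fin n) ℝ) (j : Fin n) : ℕ :=
  (rowSupport A j).length + (colSupport A j).length

theorem sum_degree (A : Matrix (Fin n) (Fin n) ℝ) : ∑ j, degree A j = 2 * nnz A := by
  simp only [degree, Finset.sum_add_distrib, sum_length_rowSupport, sum_length_colSupport]
  ring

/-! ### Updates and cycles -/

/-- The two log-sum-exp errors, halved, and the rounding of the halving stay below (n + 3) ulp,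
which is at most the accuracy of the final truncation; hence twice that accuracy. The cost is 6 deg
+ 8 ≤ 10 deg, since row and column j are both nonzero. -/
theorem runsWithin_updateCoord {P : Precision} {ℓ U : ℝ} (hℓ : 0 ≤ ℓ)
    (hL : LogsWithin P.p A L ℓ)
    (hrow : ∀ i, ∃ j, A i j ≠ 0) (hcol : ∀ j, ∃ i, A i j ≠ 0)
    (hq : P.qIter ≤ P.p) (hulp : (n + 3) * ulp P.p ≤ 1 / 2 ^ P.qIter)
    {u : Fin n → ℤ} (hu : ∀ i, |vals P.p u i| ≤ U) (hU : 4 * (U + ℓ + n + 2) < 2 ^ P.p)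
    (j : Fin n) :
    RunsWithin (updateCoord P A L u j) (10 * degree A j) fun w => ∃ x : ℤ,
      |val P.p x - exactUpdate (logMatrix P.p A L) (vals P.p u) j| ≤ 2 / 2 ^ P.qIter ∧
        w = Function.update u j x := by
  have hU0 : 0 ≤ U := (abs_nonneg _).trans (hu j)
  have hn0 : (0 : ℝ) ≤ n := by positivity
  obtain ⟨jr, hjr⟩ := hrow j
  obtain ⟨jc, hjc⟩ := hcol j
  have hrl : 0 < (rowSupport A j).length := List.length_pos_of_mem (mem_rowSupport.2 hjr)
  have hcl : 0 < (colSupport A j).length := List.length_pos_of_mem (mem_colSupport.2 hjc)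
  have hrn : ((rowSupport A j).length : ℝ) ≤ n := by exact_mod_cast length_rowSupport_le A j
  have hcn : ((colSupport A j).length : ℝ) ≤ n := by exact_mod_cast length_colSupport_le A j
  have hup := ulp_pos P.p
  have hrl' := mul_le_mul_of_nonneg_right hrn hup.le
  have hcl' := mul_le_mul_of_nonneg_right hcn hup.le
  unfold updateCoord
  refine ((runsWithin_colLogs hL hu (by linarith) j).bind
    (c₂ := (rowSupport A j).length * 2 + ((4 * (colSupport A j).length + 2)
      + ((4 * (rowSupport A j).length + 2) + 4))) ?_).mono
    (by unfold degree; omega) fun _ h => h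
  rintro _ rfl
  refine (runsWithin_rowLogs hL hu (by linarith) j).bind ?_
  rintro _ rfl
  refine ((runsWithin_logSumExp (Z := 2 * U + ℓ)
    (by simpa using List.ne_nil_of_length_pos hcl) ?_ ?_).mono
      (by rw [List.length_map]) fun _ h => h).bind ?_
  · intro z hz
    obtain ⟨i, hi, rfl⟩ := List.mem_map.1 hz
    exact abs_val_entryWord_le hL hu (mem_colSupport.1 hi)
  · rw [List.length_map]; linarith
  rintro c ⟨c1, c2, c3⟩
  refine ((runsWithin_logSumExp (Z := 2 * U + ℓ)
    (by simpa using List.ne_nil_of_length_pos hrl) ?_ ?_).mono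
      (by rw [List.length_map]) fun _ h => h).bind ?_
  · intro z hz
    obtain ⟨i, hi, rfl⟩ := List.mem_map.1 hz
    exact abs_val_entryWord_le hL hu (mem_rowSupport.1 hi)
  · rw [List.length_map]; linarith
  rintro r ⟨r1, r2, r3⟩
  rw [List.length_map] at c2 c3 r2 r3
  rw [List.map_map] at c1 c2 r1 r2
  have hc := colSum_logMatrix (p := P.p) (A := A) (L := L) u j
  have hr := rowSum_logMatrix (p := P.p) (A := A) (L := L) u j
  change val P.p c ≤ Real.log ((colSupport A j).map fun i =>
    Real.exp (val P.p (entryWord L u (i, j)))).sum at c1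
  change Real.log ((colSupport A j).map fun i =>
    Real.exp (val P.p (entryWord L u (i, j)))).sum - _ ≤ val P.p c at c2
  change val P.p r ≤ Real.log ((rowSupport A j).map fun i =>
    Real.exp (val P.p (entryWord L u (j, i)))).sum at r1
  change Real.log ((rowSupport A j).map fun i =>
    Real.exp (val P.p (entryWord L u (j, i)))).sum - _ ≤ val P.p r at r2
  rw [← hc] at c1 c2
  rw [← hr] at r1 r2
  have c4 := abs_le.1 c3
  have r4 := abs_le.1 r3
  have uj := abs_le.1 (hu j)
  refine ((runsWithin_emit ?_).bind (c₂ := 3) ?_).mono le_rfl fun _ h => h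
  · rw [val_sub, abs_lt]; constructor <;> linarith
  rintro _ rfl
  have hx : |val P.p (c - r) / 2| ≤ 2 * U + ℓ + n + 1 := by
    rw [val_sub, abs_le]; constructor <;> linarith
  refine ((runsWithin_emit_floor (by linarith)).bind (c₂ := 2) ?_).mono le_rfl fun _ h => h
  rintro x rfl
  have h1 := val_floor_le P.p (val P.p (c - r) / 2)
  have h2 := sub_ulp_le_val_floor P.p (val P.p (c - r) / 2)
  have h3 := (abs_val_floor_le P.p (val P.p (c - r) / 2)).trans (add_le_add_left hx 1)
  set x := ⌊val P.p (c - r) / 2 * 2 ^ P.p⌋ with hxdef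
  have h4 := abs_le.1 h3
  have hy : |val P.p (u j + x)| ≤ 3 * U + ℓ + n + 2 := by
    rw [val_add, abs_le]
    simp only [vals] at uj
    constructor <;> linarith
  refine ((runsWithin_emit (by linarith)).bind (c₂ := 1) ?_).mono le_rfl fun _ h => h
  rintro _ rfl
  refine ((runsWithin_truncTo hq (by linarith)).bind (c₂ := 0) ?_).mono le_rfl fun _ h => h
  rintro y ⟨y1, y2, -⟩
  refine RunsWithin.pure ⟨y, ?_, rfl⟩
  rw [val_sub] at h1 h2
  rw [val_add] at y1 y2
  have hex : exactUpdate (logMatrix P.p A L) (vals P.p u) j = val P.p (u j)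
      + 1 / 2 * Real.log (colSum (expScaled (logMatrix P.p A L) (vals P.p u)) j)
      - 1 / 2 * Real.log (rowSum (expScaled (logMatrix P.p A L) (vals P.p u)) j) := rfl
  have hsum : 2 / 2 ^ P.qIter = 1 / 2 ^ P.qIter + 1 / (2 : ℝ) ^ P.qIter := by ring
  have hnu : 0 ≤ n * ulp P.p := by positivity
  rw [hex, hsum, abs_le]
  constructor <;> linarith

theorem sum_map_degree (π : Equiv.Perm (Fin n)) :
    ((List.finRange n).map fun t => 10 * degree A (π t)).sum = 20 * nnz A := by
  rw [← Fin.sum_univ_def, ← Finset.mul_sum, Equiv.sum_comp π (degree A), sum_degree]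
  ring

/-- The sup norm grows by at most W per update, which serves as the invariant against overflow. The
states s t are recorded to present the cycle as inexact Osborne updates. -/
theorem runsWithin_cycle {P : Precision} {κ U : ℝ} (hκ : 2 ≤ κ)
    (hL : LogsWithin P.p A L (Real.log κ)) (hB : IsAdmissible (logMatrix P.p A L))
    (hB1 : ∀ i j, 0 < logMatrix P.p A L i j → 1 ≤ logMatrix P.p A L i j)
    (hBκ : total (logMatrix P.p A L) ≤ κ)
    (hrow : ∀ i, ∃ j, A i j ≠ 0) (hcol : ∀ j, ∃ i, A i j ≠ 0)
    (hq : P.qIter ≤ P.p) (hulp : (n + 3) * ulp P.p ≤ 1 / 2 ^ P.qIter) {W : ℝ}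
    (hW : 1 / 2 * Real.log κ + 2 / 2 ^ P.qIter ≤ W)
    {u : Fin n → ℤ} (hu : ∀ i, |vals P.p u i| ≤ U)
    (hU : 4 * (U + n * W + Real.log κ + n + 2) < 2 ^ P.p) (π : Equiv.Perm (Fin n)) :
    RunsWithin (cycle P A L π u) (20 * nnz A) fun w =>
      (∀ i, |vals P.p w i| ≤ U + n * W) ∧ ∃ s : ℕ → Fin n → ℤ, s 0 = u ∧ s n = w ∧
        ∀ t : Fin n, ∃ x : ℤ,
          |val P.p x - exactUpdate (logMatrix P.p A L) (vals P.p (s t)) (π t)| ≤ 2 / 2 ^ P.qIter ∧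
            s (t + 1) = Function.update (s t) (π t) x := by
  have hlog : 0 ≤ Real.log κ := Real.log_nonneg (by linarith)
  have hW0 : 0 ≤ W := le_trans (by positivity) hW
  unfold cycle
  rw [← sum_map_degree (A := A) π]
  refine (RunsWithin.foldlM_states
    (fun t w => ∀ i, |vals P.p w i| ≤ U + t * W)
    (fun t w w' => ∃ x : ℤ,
      |val P.p x - exactUpdate (logMatrix P.p A L) (vals P.p w) (π t)| ≤ 2 / 2 ^ P.qIter ∧
        w' = Function.update w (π t) x)
    _ (List.finRange n) 0 (by simpa using hu) ?_).mono le_rfl ?_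
  · intro t _ i w hi hw
    rw [List.length_finRange, zero_add] at hi
    have hin : (i : ℝ) * W ≤ n * W := by gcongr
    refine (runsWithin_updateCoord hlog hL hrow hcol hq hulp hw (by linarith) (π t)).mono le_rfl ?_
    rintro w' ⟨x, hx, rfl⟩
    refine ⟨fun l => ?_, x, hx, rfl⟩
    rw [vals_update]
    by_cases hl : l = π t
    · subst hl
      rw [Function.update_self]
      have h1 := abs_exactUpdate_le hB hB1 hBκ hw (π t)
      have h2 := abs_sub_abs_le_abs_sub (val P.p x)
        (exactUpdate (logMatrix P.p A L) (vals P.p w) (π t))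
      push_cast
      linarith
    · rw [Function.update_of_ne hl]
      push_cast
      linarith [hw l]
  · rintro w ⟨hI, s, h0, hs, hR⟩
    rw [List.length_finRange] at hI hs
    refine ⟨by simpa using hI, s, h0, hs, fun t => ?_⟩
    have := hR t (by simp)
    simpa using this

/-! ### The termination test -/

theorem abs_sum_abs_sub_sub_le {ι : Type*} (s : Finset ι) (a b a' b' e : ι → ℝ)
    (h : ∀ i ∈ s, |a i - a' i| + |b i - b' i| ≤ e i) :
    |(∑ i ∈ s, |a i - b i|) - (∑ i ∈ s, |a' i - b' i|)| ≤ ∑ i ∈ s, e i := by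
  rw [← Finset.sum_sub_distrib]
  refine (Finset.abs_sum_le_sum_abs _ _).trans (Finset.sum_le_sum fun i hi => ?_)
  refine (abs_abs_sub_abs_le _ _).trans ?_
  have : a i - b i - (a' i - b' i) = (a i - a' i) - (b i - b' i) := by ring
  rw [this]
  exact (abs_sub _ _).trans (h i hi)

/-- The comparison is with about ε/2, and rounding shifts the estimate by O(m ulp), which `hm` makes
small against ε. Neither answer is exact, but 3ε/4 and ε/4 are safely on the two sides. -/
theorem runsWithin_balanceTest {P : Precision} {ℓ U ε : ℝ} (hℓ : 0 ≤ ℓ)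
    (hL : LogsWithin P.p A L ℓ) (hn : 0 < n) (hrow : ∀ i, ∃ j, A i j ≠ 0)
    {u : Fin n → ℤ} (hu : ∀ i, |vals P.p u i| ≤ U) (hU : 4 * (U + ℓ) < 2 ^ P.p)
    (hε : 0 < ε) (hε1 : ε < 1) {e : ℤ} (he : val P.p e ≤ ε) (he' : ε - ulp P.p ≤ val P.p e)
    (hm : 20 * (nnz A * ulp P.p) ≤ ε) (hm' : 2 * (nnz A : ℝ) + 4 < 2 ^ P.p) :
    RunsWithin (balanceTest P A L e u) (26 * nnz A) fun b =>
      if b then imbalance (expScaled (logMatrix P.p A L) (vals P.p u)) ≤ 3 / 4 * ε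
      else ε / 4 ≤ imbalance (expScaled (logMatrix P.p A L) (vals P.p u)) := by
  have hU0 : 0 ≤ U := (abs_nonneg _).trans (hu ⟨0, hn⟩)
  have hup := ulp_pos P.p
  have hnnz : 0 < nnz A := by
    obtain ⟨j, hj⟩ := hrow ⟨0, hn⟩
    rw [← length_edges]
    exact List.length_pos_of_mem (mem_edges (e := (⟨0, hn⟩, j)).2 hj)
  have hnn : n ≤ nnz A := by
    rw [← sum_length_rowSupport]
    calc n = ∑ _i : Fin n, 1 := by simp
      _ ≤ _ := Finset.sum_le_sum fun i _ => by
          obtain ⟨j, hj⟩ := hrow i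
          exact List.length_pos_of_mem (mem_rowSupport.2 hj)
  have hnnz' : (1 : ℝ) ≤ nnz A := by exact_mod_cast hnnz
  set zs := (edges A).map (entryWord L u) with hzs
  have hzlen : zs.length = nnz A := by rw [hzs, List.length_map, length_edges]
  unfold balanceTest
  refine ((RunsWithin.mapM (g := entryWord L u) (c := 2) (edges A) fun x hx =>
      runsWithin_logScaled hL hu (by linarith) (mem_edges.1 hx)).bind
    (c₂ := nnz A + (3 * nnz A + (14 * nnz A + 3 * n + 3))) ?_).mono
      (by rw [length_edges]; omega) fun _ h => h
  rintro _ rfl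
  rw [← hzs]
  have hzabs : ∀ z ∈ zs, |val P.p z| ≤ 2 * U + ℓ := by
    intro z hz
    obtain ⟨⟨i, j⟩, hi, rfl⟩ := List.mem_map.1 hz
    exact abs_val_entryWord_le hL hu (mem_edges.1 hi)
  have hne : zs ≠ [] := List.ne_nil_of_length_pos (by omega)
  refine ((runsWithin_listMax hne fun z hz =>
    (hzabs z hz).trans_lt (by linarith)).mono hzlen.le fun _ h => h).bind ?_
  rintro M ⟨hM, hmax⟩
  have hdiff : ∀ z ∈ zs, |val P.p (z - M)| < 2 ^ P.p := by
    intro z hz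
    have h1 := abs_le.1 (hzabs z hz)
    have h2 := abs_le.1 (hzabs M hM)
    rw [val_sub, abs_lt]
    constructor <;> linarith
  have hrowmem : ∀ j, ∀ z ∈ (rowSupport A j).map fun i => entryWord L u (j, i), z ∈ zs := by
    intro j z hz
    obtain ⟨i, hi, rfl⟩ := List.mem_map.1 hz
    exact List.mem_map.2 ⟨(j, i), mem_edges.2 (mem_rowSupport.1 hi), rfl⟩
  have hcolmem : ∀ j, ∀ z ∈ (colSupport A j).map fun i => entryWord L u (i, j), z ∈ zs := by
    intro j z hz
    obtain ⟨i, hi, rfl⟩ := List.mem_map.1 hz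
    exact List.mem_map.2 ⟨(i, j), mem_edges.2 (mem_colSupport.1 hi), rfl⟩
  have hrlen : ∀ j, (rowSupport A j).length ≤ nnz A := by
    intro j
    rw [← sum_length_rowSupport]
    exact Finset.single_le_sum (f := fun i => (rowSupport A i).length)
      (fun _ _ => Nat.zero_le _) (Finset.mem_univ j)
  have hclen : ∀ j, (colSupport A j).length ≤ nnz A := by
    intro j
    rw [← sum_length_colSupport]
    exact Finset.single_le_sum (f := fun i => (colSupport A i).length)
      (fun _ _ => Nat.zero_le _) (Finset.mem_univ j)
  refine ((runsWithin_sumExp hmax hdiff (by rw [hzlen]; linarith)).mono (by rw [hzlen])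
    fun _ h => h).bind ?_
  rintro _ rfl
  set T := sumExpWord P.p M zs with hT
  set r : Fin n → ℤ := fun j =>
    sumExpWord P.p M ((rowSupport A j).map fun i => entryWord L u (j, i)) with hr
  set c : Fin n → ℤ := fun j =>
    sumExpWord P.p M ((colSupport A j).map fun i => entryWord L u (i, j)) with hc
  have hr0 : ∀ j, 0 ≤ r j := fun j => sumExpWord_nonneg _ _ _
  have hc0 : ∀ j, 0 ≤ c j := fun j => sumExpWord_nonneg _ _ _
  have hrle : ∀ j, val P.p (r j) ≤ (rowSupport A j).length := by
    intro j
    have := val_sumExpWord_le_length (p := P.p) (M := M) fun z hz => hmax z (hrowmem j z hz)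
    rwa [List.length_map] at this
  have hcle : ∀ j, val P.p (c j) ≤ (colSupport A j).length := by
    intro j
    have := val_sumExpWord_le_length (p := P.p) (M := M) fun z hz => hmax z (hcolmem j z hz)
    rwa [List.length_map] at this
  have v0 : ∀ x : ℤ, 0 ≤ x → 0 ≤ val P.p x := fun x hx => by
    rw [← val_zero P.p]; exact val_le_val.2 hx
  have hfull : val P.p (∑ j, |r j - c j|) = ∑ j, |val P.p (r j) - val P.p (c j)| := by
    rw [Fin.sum_univ_def, val_list_sum, List.map_map, Fin.sum_univ_def]
    congr 1
    exact List.map_congr_left fun j _ => by simp [val_abs, val_sub]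
  have hrc : ∀ j, |val P.p (r j) - val P.p (c j)| ≤ degree A j := by
    intro j
    have h1 := v0 _ (hr0 j)
    have h2 := v0 _ (hc0 j)
    have h3 := hrle j
    have h4 := hcle j
    unfold degree
    push_cast
    rw [abs_le]; constructor <;> linarith
  have hsumdeg : ∑ j, (degree A j : ℝ) = 2 * nnz A := by exact_mod_cast sum_degree A
  have hfull_le : val P.p (∑ j, |r j - c j|) ≤ 2 * nnz A := by
    rw [hfull, ← hsumdeg]
    exact Finset.sum_le_sum fun j _ => hrc j
  have hcost : ((List.finRange n).map fun j => 7 * degree A j + 3).sum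
      = 14 * nnz A + 3 * n := by
    rw [← Fin.sum_univ_def, Finset.sum_add_distrib, ← Finset.mul_sum, sum_degree]
    simp; ring
  have hfold := RunsWithin.foldlM (f := fun s j => do
      let zr ← (rowSupport A j).mapM fun i => logScaled P.p L u (j, i)
      let zc ← (colSupport A j).mapM fun i => logScaled P.p L u (i, j)
      let r ← sumExp P.p M zr
      let c ← sumExp P.p M zc
      let x ← sub P.p r c
      let x ← vabs P.p x
      add P.p s x)
    (fun rem s => 0 ≤ s ∧ s + (rem.map fun j => |r j - c j|).sum = ∑ j, |r j - c j|)
    (fun j => 7 * degree A j + 3) (List.finRange n) (b := 0)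
    ⟨le_rfl, by rw [zero_add, Fin.sum_univ_def]⟩ (by
      rintro j rem s hs ⟨hs0, hsum⟩
      rw [List.map_cons, List.sum_cons] at hsum
      have hrem : 0 ≤ (rem.map fun j => |r j - c j|).sum := by
        refine List.sum_nonneg fun x hx => ?_
        obtain ⟨z, -, rfl⟩ := List.mem_map.1 hx
        exact abs_nonneg _
      have hjd := hrc j
      have hdj : (degree A j : ℝ) ≤ 2 * nnz A := by
        rw [← hsumdeg]
        exact Finset.single_le_sum (f := fun i => (degree A i : ℝ))
          (fun _ _ => Nat.cast_nonneg _) (Finset.mem_univ j)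
      have l1 : ((rowSupport A j).length : ℝ) ≤ nnz A := by exact_mod_cast hrlen j
      have l2 : ((colSupport A j).length : ℝ) ≤ nnz A := by exact_mod_cast hclen j
      refine ((runsWithin_rowLogs hL hu (by linarith) j).bind
        (c₂ := (colSupport A j).length * 2 + (3 * (rowSupport A j).length
          + (3 * (colSupport A j).length + 3))) ?_).mono
        (by unfold degree; omega) fun _ h => h
      rintro _ rfl
      refine (runsWithin_colLogs hL hu (by linarith) j).bind ?_
      rintro _ rfl
      refine ((runsWithin_sumExp (fun z hz => hmax z (hrowmem j z hz))
        (fun z hz => hdiff z (hrowmem j z hz)) (by rw [List.length_map]; linarith)).mono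
        (by rw [List.length_map]) fun _ h => h).bind ?_
      rintro _ rfl
      refine ((runsWithin_sumExp (fun z hz => hmax z (hcolmem j z hz))
        (fun z hz => hdiff z (hcolmem j z hz)) (by rw [List.length_map]; linarith)).mono
        (by rw [List.length_map]) fun _ h => h).bind ?_
      rintro _ rfl
      change RunsWithin (sub P.p (r j) (c j) >>= fun x => vabs P.p x >>= fun x => add P.p s x) 3 _
      refine ((runsWithin_emit ?_).bind (c₂ := 2) ?_).mono le_rfl fun _ h => h
      · rw [val_sub]; linarith
      rintro _ rfl
      refine ((runsWithin_emit ?_).bind (c₂ := 1) ?_).mono le_rfl fun _ h => h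
      · rw [val_abs, abs_abs, val_sub]; linarith
      rintro _ rfl
      refine (runsWithin_emit ?_).mono le_rfl ?_
      · have a0 : 0 ≤ s + |r j - c j| := add_nonneg hs0 (abs_nonneg _)
        have a1 : s + |r j - c j| ≤ ∑ j, |r j - c j| := by linarith
        rw [abs_of_nonneg (v0 _ a0)]
        have := (val_le_val (p := P.p)).2 a1
        linarith
      · rintro _ rfl
        exact ⟨add_nonneg hs0 (abs_nonneg _), by linarith⟩)
  rw [hcost] at hfold
  refine (hfold.bind (c₂ := 3) ?_).mono (by omega) fun _ h => h
  rintro _ ⟨-, rfl'⟩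
  rw [List.map_nil, List.sum_nil, add_zero] at rfl'
  subst rfl'
  have hm1 : ulp P.p ≤ nnz A * ulp P.p := le_mul_of_one_le_left hup.le hnnz'
  have hve : |val P.p e / 2| ≤ 1 := by rw [abs_le]; constructor <;> linarith
  refine ((runsWithin_emit_floor (by linarith)).bind (c₂ := 2) ?_).mono le_rfl fun _ h => h
  rintro _ rfl
  have g1 := val_floor_le P.p (val P.p e / 2)
  have g2 := sub_ulp_le_val_floor P.p (val P.p e / 2)
  set e₂ := ⌊val P.p e / 2 * 2 ^ P.p⌋ with he₂
  have T1 : 1 ≤ val P.p T := one_le_val_sumExpWord hM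
  have T2 : val P.p T ≤ nnz A := by
    have := val_sumExpWord_le_length (p := P.p) hmax
    rwa [hzlen] at this
  have e0 : 0 ≤ val P.p e₂ := by linarith
  have e1 : val P.p e₂ ≤ 1 := by linarith
  refine ((runsWithin_emit_floor ?_).bind (c₂ := 1) ?_).mono le_rfl fun _ h => h
  · rw [abs_of_nonneg (by positivity)]
    have : val P.p e₂ * val P.p T ≤ 1 * nnz A := by gcongr
    linarith
  rintro _ rfl
  have k1 := val_floor_le P.p (val P.p e₂ * val P.p T)
  have k2 := sub_ulp_le_val_floor P.p (val P.p e₂ * val P.p T)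
  refine (runsWithin_vle _ _).mono le_rfl ?_
  rintro _ rfl
  set bound := ⌊val P.p e₂ * val P.p T * 2 ^ P.p⌋ with hbound
  -- comparison with the exact quantities
  set N := expScaled (logMatrix P.p A L) (vals P.p u) with hN
  set x := Real.exp (-val P.p M) with hx
  have hx0 : 0 < x := Real.exp_pos _
  have t1 := val_sumExpWord_le P.p M zs
  have t2 := le_val_sumExpWord P.p M zs
  have ht : (zs.map fun z => Real.exp (val P.p (z - M))).sum = x * total N := by
    rw [sum_exp_sub, hzs, List.map_map, total_logMatrix]; rfl
  rw [ht, hzlen] at t2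
  rw [ht] at t1
  rw [← hT] at t1 t2
  have herr : |(∑ j, |val P.p (r j) - val P.p (c j)|) - (∑ j, |x * rowSum N j - x * colSum N j|)|
      ≤ ∑ j, degree A j * ulp P.p := by
    refine abs_sum_abs_sub_sub_le _ _ _ _ _ _ fun j _ => ?_
    have r1 := val_sumExpWord_le P.p M ((rowSupport A j).map fun i => entryWord L u (j, i))
    have r2 := le_val_sumExpWord P.p M ((rowSupport A j).map fun i => entryWord L u (j, i))
    have c1 := val_sumExpWord_le P.p M ((colSupport A j).map fun i => entryWord L u (i, j))
    have c2 := le_val_sumExpWord P.p M ((colSupport A j).map fun i => entryWord L u (i, j))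
    have hr' : (((rowSupport A j).map fun i => entryWord L u (j, i)).map
        fun z => Real.exp (val P.p (z - M))).sum = x * rowSum N j := by
      rw [sum_exp_sub, List.map_map, rowSum_logMatrix]; rfl
    have hc' : (((colSupport A j).map fun i => entryWord L u (i, j)).map
        fun z => Real.exp (val P.p (z - M))).sum = x * colSum N j := by
      rw [sum_exp_sub, List.map_map, colSum_logMatrix]; rfl
    rw [hr'] at r1 r2
    rw [hc'] at c1 c2
    rw [List.length_map] at r2 c2
    -- Rounding down makes both errors one-sided.
    rw [abs_of_nonpos (by simp only [hr]; linarith), abs_of_nonpos (by simp only [hc]; linarith)]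
    simp only [hr, hc, degree]
    push_cast
    linarith
  rw [← Finset.sum_mul, hsumdeg, ← hfull] at herr
  have hexact : ∑ j, |x * rowSum N j - x * colSum N j| = x * ∑ j, |rowSum N j - colSum N j| := by
    rw [Finset.mul_sum]
    refine Finset.sum_congr rfl fun j _ => ?_
    rw [← mul_sub, abs_mul, abs_of_pos hx0]
  rw [hexact] at herr
  have htot : 1 ≤ x * total N := T1.trans t1
  have htot0 : 0 < total N := by
    by_contra hneg
    have := mul_nonpos_of_nonneg_of_nonpos hx0.le (not_lt.1 hneg)
    linarith
  -- The factor x = exp(-M) cancels in the imbalance. It normalizes the total to τ ≥ 1, so additive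
  -- errors can be measured against τ.
  have himb : imbalance N = (x * ∑ j, |rowSum N j - colSum N j|) / (x * total N) := by
    rw [imbalance_eq, mul_div_mul_left _ _ hx0.ne']
  rw [himb]
  generalize x * total N = τ at *
  generalize x * ∑ j, |rowSum N j - colSum N j| = d at *
  obtain ⟨herr1, herr2⟩ := abs_le.1 herr
  by_cases hle : ∑ j, |r j - c j| ≤ bound
  · simp only [hle, decide_true, if_true]
    rw [div_le_iff₀ (by linarith)]
    have a1 := (val_le_val (p := P.p)).2 hle
    have a2 : val P.p e₂ * val P.p T ≤ ε / 2 * τ := by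
      gcongr
      linarith
    nlinarith
  · simp only [hle, decide_false, Bool.false_eq_true, if_false]
    rw [le_div_iff₀ (by linarith)]
    have a1 := (val_le_val (p := P.p)).2 (not_le.1 hle).le
    have a2 : (ε / 2 - 3 / 2 * ulp P.p) * val P.p T ≤ val P.p e₂ * val P.p T := by
      gcongr
      linarith
    have a3 : (ε / 2 - 3 / 2 * ulp P.p) * (τ - nnz A * ulp P.p)
        ≤ (ε / 2 - 3 / 2 * ulp P.p) * val P.p T := by
      gcongr
      linarith
    -- The products that bound every error term by a multiple of ετ, so that the rest is linear.
    have b1 : 0 ≤ (nnz A * ulp P.p - ulp P.p) * τ := mul_nonneg (by linarith) (by linarith)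
    have b2 : 0 ≤ nnz A * ulp P.p * (τ - 1) := mul_nonneg (by positivity) (by linarith)
    have b3 : 0 ≤ nnz A * ulp P.p * (1 - ε) := mul_nonneg (by positivity) (by linarith)
    have b4 : 0 ≤ ulp P.p * (nnz A * ulp P.p) := by positivity
    have b5 : 0 ≤ (ε - 20 * (nnz A * ulp P.p)) * τ := mul_nonneg (by linarith) (by linarith)
    have b6 : (ε / 2 - 3 / 2 * ulp P.p) * (τ - nnz A * ulp P.p)
      = ε / 2 * τ - 3 / 2 * (ulp P.p * τ) - ε / 2 * (nnz A * ulp P.p)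
        + 3 / 2 * (ulp P.p * (nnz A * ulp P.p)) := by ring
    linarith

/-! ### Preprocessing -/

theorem minEntry_spec (hn : 0 < n) (hA : ∀ i j, 0 ≤ A i j) (hrow : ∀ i, ∃ j, A i j ≠ 0) :
    0 < minEntry A ∧ ∀ i j, A i j ≠ 0 → minEntry A ≤ A i j := by
  set S : Set ℝ := {x : ℝ | ∃ i j, A i j ≠ 0 ∧ A i j = x} with hS
  have hfin : S.Finite := by
    refine (Set.finite_range fun e : Fin n × Fin n => A e.1 e.2).subset ?_
    rintro x ⟨i, j, -, rfl⟩
    exact ⟨(i, j), rfl⟩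
  obtain ⟨j, hj⟩ := hrow ⟨0, hn⟩
  have hne : S.Nonempty := ⟨_, ⟨0, hn⟩, j, hj, rfl⟩
  constructor
  · obtain ⟨i, j, h1, h2⟩ := hne.csInf_mem hfin
    have h3 : A i j = minEntry A := h2
    rw [← h3]
    exact lt_of_le_of_ne (hA i j) (Ne.symm h1)
  · intro i j hij
    exact csInf_le hfin.bddBelow ⟨i, j, hij, rfl⟩

theorem total_div_minEntry : total (fun i j => A i j / minEntry A) = kappa A := by
  unfold total kappa
  simp only [Finset.sum_div]

theorem div_minEntry_le_kappa (hn : 0 < n) (hA : ∀ i j, 0 ≤ A i j) (hrow : ∀ i, ∃ j, A i j ≠ 0)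
    (i j : Fin n) : A i j / minEntry A ≤ kappa A := by
  have hm := (minEntry_spec hn hA hrow).1
  unfold kappa
  gcongr
  calc A i j ≤ ∑ j, A i j :=
        Finset.single_le_sum (f := fun b => A i b) (fun _ _ => hA _ _) (Finset.mem_univ j)
    _ ≤ ∑ i, ∑ j, A i j := Finset.single_le_sum (f := fun a => ∑ j, A a j)
        (fun _ _ => Finset.sum_nonneg fun _ _ => hA _ _) (Finset.mem_univ i)

theorem card_le_kappa (hn : 0 < n) (hA : ∀ i j, 0 ≤ A i j) (hrow : ∀ i, ∃ j, A i j ≠ 0) :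
    (n : ℝ) ≤ kappa A := by
  obtain ⟨hm, hle⟩ := minEntry_spec hn hA hrow
  rw [← total_div_minEntry]
  calc (n : ℝ) = ∑ _i : Fin n, (1 : ℝ) := by simp
    _ ≤ _ := Finset.sum_le_sum fun i _ => by
      obtain ⟨j, hj⟩ := hrow i
      refine ((one_le_div hm).2 (hle i j hj)).trans ?_
      exact Finset.single_le_sum (f := fun b => A i b / minEntry A)
        (fun _ _ => div_nonneg (hA _ _) hm.le) (Finset.mem_univ j)

/-- In units of the smallest entry all inputs are at least 1, where log is 1-Lipschitz: reading and
log lose one ulp each, truncation the rest. Rounding down gives 0 ≤ L ≤ log, hence entries of B at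
least 1 and a sum at most κ. -/
theorem runsWithin_logEntries {P : Precision} (hn : 0 < n) (hA : ∀ i j, 0 ≤ A i j)
    (hrow : ∀ i, ∃ j, A i j ≠ 0) (hq : P.qLog ≤ P.p) (hulp : 2 * ulp P.p ≤ 1 / 2 ^ P.qLog)
    (hκ : kappa A + 1 < 2 ^ P.p) :
    RunsWithin (logEntries P A) (3 * nnz A) fun L => ∀ i j, A i j ≠ 0 →
      0 ≤ val P.p (L (i, j)) ∧ val P.p (L (i, j)) ≤ Real.log (A i j / minEntry A) ∧
        Real.log (A i j / minEntry A) - 2 / 2 ^ P.qLog ≤ val P.p (L (i, j)) := by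
  obtain ⟨hm, hle⟩ := minEntry_spec hn hA hrow
  unfold logEntries
  refine (RunsWithin.foldlM (fun rem L => ∀ e ∈ edges A, e ∉ rem →
      0 ≤ val P.p (L e) ∧ val P.p (L e) ≤ Real.log (A e.1 e.2 / minEntry A) ∧
        Real.log (A e.1 e.2 / minEntry A) - 2 / 2 ^ P.qLog ≤ val P.p (L e)) (fun _ => 3)
      (edges A) (fun e he hne => absurd he hne) ?_).mono ?_ ?_
  · rintro e rem L hs hI
    have he := mem_edges.1 (hs.subset List.mem_cons_self)
    set a := A e.1 e.2 / minEntry A with ha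
    have a1 : 1 ≤ a := (one_le_div hm).2 (hle _ _ he)
    have aκ : a ≤ kappa A := div_minEntry_le_kappa hn hA hrow _ _
    refine ((runsWithin_emit_floor (by rw [abs_of_nonneg (by linarith)]; linarith)).bind
      (c₂ := 2) ?_).mono le_rfl fun _ h => h
    rintro _ rfl
    have f1 := val_floor_le P.p a
    have f2 := sub_ulp_le_val_floor P.p a
    have f3 : 1 ≤ val P.p ⌊a * 2 ^ P.p⌋ := by
      rw [← val_two_pow P.p, val_le_val, Int.le_floor]
      push_cast
      exact le_mul_of_one_le_left (by positivity) a1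
    set w := ⌊a * 2 ^ P.p⌋
    have w0 : 0 < w := by
      by_contra hc
      have : val P.p w ≤ val P.p 0 := val_le_val.2 (by omega)
      rw [val_zero] at this
      linarith
    have hv0 : 0 < val P.p w := by linarith
    have l0 : 0 ≤ Real.log (val P.p w) := Real.log_nonneg f3
    have l1 : Real.log (val P.p w) ≤ Real.log a := Real.log_le_log hv0 f1
    have l2 : Real.log a - ulp P.p ≤ Real.log (val P.p w) := by
      have := Real.log_le_sub_one_of_pos (div_pos (by linarith : 0 < a) hv0)
      rw [Real.log_div (by linarith) hv0.ne'] at this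
      have : a / val P.p w - 1 ≤ ulp P.p := by
        rw [div_sub_one hv0.ne', div_le_iff₀ hv0]
        nlinarith [ulp_pos P.p]
      linarith
    have l3 : Real.log a ≤ a - 1 := Real.log_le_sub_one_of_pos (by linarith)
    refine ((runsWithin_vlog w0 (by rw [abs_of_nonneg l0]; linarith)).bind
      (c₂ := 1) ?_).mono le_rfl fun _ h => h
    rintro _ rfl
    have g1 := val_floor_le P.p (Real.log (val P.p w))
    have g2 := sub_ulp_le_val_floor P.p (Real.log (val P.p w))
    have g3 : 0 ≤ ⌊Real.log (val P.p w) * 2 ^ P.p⌋ := Int.floor_nonneg.2 (by positivity)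
    have g4 : 0 ≤ val P.p ⌊Real.log (val P.p w) * 2 ^ P.p⌋ := by
      rw [← val_zero P.p]; exact val_le_val.2 g3
    refine ((runsWithin_truncTo hq (by rw [abs_of_nonneg g4]; linarith)).bind
      (c₂ := 0) ?_).mono le_rfl fun _ h => h
    rintro y ⟨y1, y2, y3⟩
    refine RunsWithin.pure fun e' he' hne' => ?_
    by_cases h : e' = e
    · subst h
      rw [Function.update_self]
      have hsum : 2 / 2 ^ P.qLog = 1 / 2 ^ P.qLog + 1 / (2 : ℝ) ^ P.qLog := by ring
      refine ⟨?_, by linarith, by rw [hsum]; linarith⟩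
      rw [← val_zero P.p]
      exact val_le_val.2 (y3 g3)
    · rw [Function.update_of_ne h]
      exact hI e' he' (by simp [h, hne'])
  · simp [length_edges, mul_comm]
  · intro L hL i j hij
    exact hL (i, j) (mem_edges.2 hij) (by simp)

/-! ### Comparison of imbalances -/

/-- M' - aM lies between 0 and aτM entrywise: row and column sums each contribute at most aτ times
the total of M to the numerator, while the denominator is at least a times that total. -/
theorem imbalance_le_add {M M' : Matrix (Fin n) (Fin n) ℝ} {a τ : ℝ} (ha : 0 < a) (hτ : 0 ≤ τ)
    (hM : 0 < total M) (h1 : ∀ i j, a * M i j ≤ M' i j)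
    (h2 : ∀ i j, M' i j ≤ a * (1 + τ) * M i j) : imbalance M' ≤ imbalance M + 2 * τ := by
  have ht : a * total M ≤ total M' := by
    unfold total
    rw [Finset.mul_sum]
    refine Finset.sum_le_sum fun i _ => ?_
    rw [Finset.mul_sum]
    exact Finset.sum_le_sum fun j _ => h1 i j
  have h3 : ∀ i j, 0 ≤ M' i j - a * M i j ∧ M' i j - a * M i j ≤ a * τ * M i j := fun i j => by
    have := h1 i j
    have := h2 i j
    constructor <;> linarith
  have hr : ∀ i, 0 ≤ rowSum M' i - a * rowSum M i ∧
      rowSum M' i - a * rowSum M i ≤ a * τ * rowSum M i := fun i => by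
    unfold rowSum
    rw [Finset.mul_sum, Finset.mul_sum, ← Finset.sum_sub_distrib]
    exact ⟨Finset.sum_nonneg fun j _ => (h3 i j).1, Finset.sum_le_sum fun j _ => (h3 i j).2⟩
  have hc : ∀ i, 0 ≤ colSum M' i - a * colSum M i ∧
      colSum M' i - a * colSum M i ≤ a * τ * colSum M i := fun i => by
    unfold colSum
    rw [Finset.mul_sum, Finset.mul_sum, ← Finset.sum_sub_distrib]
    exact ⟨Finset.sum_nonneg fun j _ => (h3 j i).1, Finset.sum_le_sum fun j _ => (h3 j i).2⟩
  have hnum : ∑ i, |rowSum M' i - colSum M' i|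
      ≤ a * ∑ i, |rowSum M i - colSum M i| + 2 * (a * τ * total M) := by
    have hsplit : 2 * (a * τ * total M) = ∑ i, (a * τ * rowSum M i + a * τ * colSum M i) := by
      rw [Finset.sum_add_distrib, ← Finset.mul_sum, ← Finset.mul_sum, ← total_eq_sum_rowSum,
        ← total_eq_sum_colSum]; ring
    rw [hsplit, Finset.mul_sum, ← Finset.sum_add_distrib]
    refine Finset.sum_le_sum fun i _ => ?_
    obtain ⟨r1, r2⟩ := hr i
    obtain ⟨c1, c2⟩ := hc i
    have e1 := mul_le_mul_of_nonneg_left (le_abs_self (rowSum M i - colSum M i)) ha.le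
    have e2 := mul_le_mul_of_nonneg_left (neg_abs_le (rowSum M i - colSum M i)) ha.le
    rw [abs_le]; constructor <;> linarith
  have ht' : 0 < total M' := (mul_pos ha hM).trans_le ht
  rw [imbalance_eq, imbalance_eq, div_add' _ _ _ hM.ne', div_le_div_iff₀ ht' hM]
  have hs : 0 ≤ ∑ i, |rowSum M i - colSum M i| := Finset.sum_nonneg fun _ _ => abs_nonneg _
  have k1 := mul_le_mul_of_nonneg_right hnum hM.le
  have k2 := mul_le_mul_of_nonneg_left ht
    (by positivity : 0 ≤ (∑ i, |rowSum M i - colSum M i|) + 2 * τ * total M)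
  linarith

/-! ### The main loop -/

/-- All earlier tests failed, so the iterates so far form an inexact iteration with imbalances at
least ε/4. By `hK` this bounds k, which in turn bounds the iterates and excludes overflow in the
next cycle. -/
theorem runsWithin_loop {P : Precision} {κ ε : ℝ} {Kmax : ℕ} {L : Fin n × Fin n → ℤ} {e : ℤ}
    (hn : 0 < n) (hκ : 2 ≤ κ)
    (hL : LogsWithin P.p A L (Real.log κ)) (hB : IsAdmissible (logMatrix P.p A L))
    (hB1 : ∀ i j, 0 < logMatrix P.p A L i j → 1 ≤ logMatrix P.p A L i j)
    (hBκ : total (logMatrix P.p A L) ≤ κ)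
    (hrow : ∀ i, ∃ j, A i j ≠ 0) (hcol : ∀ j, ∃ i, A i j ≠ 0)
    (hq : P.qIter ≤ P.p) (hulp : (n + 3) * ulp P.p ≤ 1 / 2 ^ P.qIter) {W : ℝ}
    (hW : 1 / 2 * Real.log κ + 2 / 2 ^ P.qIter ≤ W)
    (hU : 4 * ((Kmax + 1) * (n * W) + Real.log κ + n + 2) < 2 ^ P.p)
    (hε : 0 < ε) (hε1 : ε < 1) (he : val P.p e ≤ ε) (he' : ε - ulp P.p ≤ val P.p e)
    (hm : 20 * (nnz A * ulp P.p) ≤ ε) (hm' : 2 * (nnz A : ℝ) + 4 < 2 ^ P.p)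
    (σ : ℕ → Equiv.Perm (Fin n))
    (hK : ∀ (N : ℕ) (v : ℕ → ℕ → Fin n → ℝ),
      IsInexactOsborne (logMatrix P.p A L) σ (2 / 2 ^ P.qIter) N v →
      (∀ k < N, ε / 4 ≤ imbalance (expScaled (logMatrix P.p A L) (v (k + 1) 0))) → N ≤ Kmax)
    (fuel k : ℕ) (hfuel : Kmax < fuel + k) (u : Fin n → ℤ)
    (hu : ∀ i, |vals P.p u i| ≤ k * (n * W)) (v : ℕ → ℕ → Fin n → ℝ)
    (hv : IsInexactOsborne (logMatrix P.p A L) σ (2 / 2 ^ P.qIter) k v)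
    (hvu : v k 0 = vals P.p u)
    (him : ∀ i < k, ε / 4 ≤ imbalance (expScaled (logMatrix P.p A L) (v (i + 1) 0))) :
    RunsWithin (loop P A σ L e fuel k u) (fuel * (46 * nnz A)) fun r =>
      imbalance (expScaled (logMatrix P.p A L) (vals P.p r.2)) ≤ 3 / 4 * ε ∧
      ∃ v : ℕ → ℕ → Fin n → ℝ,
        IsInexactOsborne (logMatrix P.p A L) σ (2 / 2 ^ P.qIter) r.1 v ∧
          v r.1 0 = vals P.p r.2 := by
  have hlog : 0 ≤ Real.log κ := Real.log_nonneg (by linarith)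
  have hW0 : 0 ≤ W := le_trans (by positivity) hW
  induction fuel generalizing k u v with
  | zero =>
    -- Running out of fuel is impossible: k > Kmax by `hfuel`, but the failed tests force k ≤ Kmax.
    have := hK k v hv him
    omega
  | succ fuel ih =>
    have hkK : k ≤ Kmax := hK k v hv him
    have hkK' : (k : ℝ) + 1 ≤ Kmax + 1 := by
      have : (k : ℝ) ≤ Kmax := by exact_mod_cast hkK
      linarith
    have hsize : ((k : ℝ) + 1) * (n * W) ≤ (Kmax + 1) * (n * W) := by gcongr
    have hn0 : (0 : ℝ) ≤ n := by positivity
    refine ((runsWithin_cycle hκ hL hB hB1 hBκ hrow hcol hq hulp hW hu (by linarith)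
      (σ k)).bind (c₂ := 26 * nnz A + fuel * (46 * nnz A)) ?_).mono (by linarith) fun _ h => h
    rintro w ⟨hw, s, hs0, hsn, hstep⟩
    have hw' : ∀ i, |vals P.p w i| ≤ (k + 1 : ℕ) * (n * W) := fun i => by
      have := hw i
      push_cast
      linarith
    refine (runsWithin_balanceTest hlog hL hn hrow hw' (by push_cast; linarith) hε hε1 he he' hm
      hm').bind ?_
    -- the extended sequence of iterates
    set v' : ℕ → ℕ → Fin n → ℝ := fun i t =>
      if i < k then v i t else if i = k then vals P.p (s t) else vals P.p w with hv'
    have hvk : ∀ i ≤ k, v' i 0 = v i 0 := by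
      intro i hi
      rcases hi.lt_or_eq with h | h
      · simp [hv', h]
      · subst h
        simp [hv', hs0, hvu]
    have hvlast : v' (k + 1) 0 = vals P.p w := by simp [hv']
    have hv'ok : IsInexactOsborne (logMatrix P.p A L) σ (2 / 2 ^ P.qIter) (k + 1) v' := by
      refine ⟨by rw [hvk 0 (Nat.zero_le _)]; exact hv.init, fun i hi => ?_, fun i hi t => ?_⟩
      · rcases (Nat.lt_succ_iff.1 hi).lt_or_eq with h | h
        · rw [hvk (i + 1) h, hv.next i h]
          simp [hv', h]
        · subst h
          rw [hvlast]
          simp [hv', hsn]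
      · rcases (Nat.lt_succ_iff.1 hi).lt_or_eq with h | h
        · simpa [hv', h] using hv.step i h t
        · subst h
          obtain ⟨x, hx, hsx⟩ := hstep t
          refine ⟨val P.p x, by simpa [hv'] using hx, ?_⟩
          simp only [hv', lt_irrefl, if_false, if_true]
          rw [hsx, vals_update]
    rintro (_ | _) hb
    · simp only [Bool.false_eq_true, if_false] at hb ⊢
      refine ih (k + 1) (by omega) w hw' v' hv'ok hvlast fun i hi => ?_
      rcases (Nat.lt_succ_iff.1 hi).lt_or_eq with h | h
      · rw [hvk (i + 1) h]; exact him i h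
      · subst h
        rw [hvlast]; exact hb
    · simp only [if_true] at hb ⊢
      exact (RunsWithin.pure ⟨hb, v', hv'ok, hvlast⟩).mono (Nat.zero_le _) fun _ h => h

/-! ### The choice of the precisions -/

theorem two_pow_ceil_logb {y : ℝ} (hy : 1 ≤ y) :
    y ≤ 2 ^ ⌈Real.logb 2 y⌉₊ ∧ (2 : ℝ) ^ ⌈Real.logb 2 y⌉₊ ≤ 2 * y := by
  have hy0 : 0 < y := by linarith
  have h := Real.rpow_logb (b := 2) (by norm_num) (by norm_num) hy0
  have h0 : 0 ≤ Real.logb 2 y := Real.logb_nonneg (by norm_num) hy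
  constructor
  · calc y = (2 : ℝ) ^ Real.logb 2 y := h.symm
      _ ≤ (2 : ℝ) ^ (⌈Real.logb 2 y⌉₊ : ℝ) :=
          Real.rpow_le_rpow_of_exponent_le (by norm_num) (Nat.le_ceil _)
      _ = _ := Real.rpow_natCast _ _
  · calc (2 : ℝ) ^ ⌈Real.logb 2 y⌉₊ = (2 : ℝ) ^ (⌈Real.logb 2 y⌉₊ : ℝ) :=
          (Real.rpow_natCast _ _).symm
      _ ≤ (2 : ℝ) ^ (Real.logb 2 y + 1) :=
          Real.rpow_le_rpow_of_exponent_le (by norm_num) (Nat.ceil_lt_add_one h0).le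
      _ = 2 * y := by rw [Real.rpow_add (by norm_num), h, Real.rpow_one]; ring

/-- This holds because 18 log 2 > 12. -/
theorem pow_le_two_pow_ceil {X : ℝ} (hX : 1 ≤ X) : X ^ 12 ≤ 2 ^ ⌈18 * Real.log X⌉₊ := by
  have hl : 0 ≤ Real.log X := Real.log_nonneg hX
  have h2 := Real.log_two_gt_d9
  have h1 := Nat.le_ceil (18 * Real.log X)
  rw [← Real.log_le_log_iff (by positivity) (by positivity), Real.log_pow, Real.log_pow]
  push_cast
  nlinarith

/-- The chosen precisions are sufficient, if the number of cycles is of the order of `κ / ε²`. -/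
theorem Precision.choose_bounds {κ ε μ k : ℝ} {P : Precision} (hn : 2 ≤ n) (hnκ : (n : ℝ) ≤ κ)
    (hε : 0 < ε) (hε1 : ε < 1) (hμ : μ ≤ n * n) (hk : k ≤ 9216 * (κ / ε ^ 2))
    (hP : P = Precision.choose 18 32 2304 n κ ε) :
    (wordLength P.p : ℝ) ≤ 500000 * Real.log (n * κ / ε) ∧
    P.qLog ≤ P.p ∧ 2 * ulp P.p ≤ 1 / 2 ^ P.qLog ∧
    P.qIter ≤ P.p ∧ (n + 3) * ulp P.p ≤ 1 / 2 ^ P.qIter ∧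
    2 / 2 ^ P.qIter ≤ ε / 1152 ∧ 2 / 2 ^ P.qLog ≤ ε / 32 ∧
    4 * ((k + 1) * (n * (2 * κ)) + Real.log κ + n + 2) < 2 ^ P.p ∧ κ + 1 < 2 ^ P.p ∧
    20 * (μ * ulp P.p) ≤ ε ∧ 2 * μ + 4 < 2 ^ P.p := by
  have hn2 : (2 : ℝ) ≤ n := by exact_mod_cast hn
  have hκ2 : 2 ≤ κ := hn2.trans hnκ
  have hlogκ : Real.log κ ≤ κ - 1 := Real.log_le_sub_one_of_pos (by linarith)
  have hnκ4 : 2 * κ ≤ n * κ := by gcongr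
  have hnn : (n : ℝ) * n ≤ n * κ := by gcongr
  set X : ℝ := n * κ / ε with hX
  have hXε : X * ε = n * κ := by rw [hX]; field_simp
  have hκX' : κ / ε ≤ X := by
    rw [hX]; gcongr; linarith
  have hnX' : n / ε ≤ X := by
    rw [hX]; gcongr; linarith
  have hεX : 1 / ε ≤ X := by
    rw [hX]; gcongr; linarith
  have hε1' : 1 ≤ 1 / ε := by rw [le_div_iff₀ hε]; linarith
  have hX0 : 0 < X := by linarith
  have hXεX : X * ε ≤ X := mul_le_of_le_one_right hX0.le hε1.le
  have hX4 : 4 ≤ X := by linarith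
  have hκX : κ ≤ X := by linarith
  have hnX : (n : ℝ) ≤ X := hnκ.trans hκX
  have hμX : μ ≤ X * ε := by linarith
  have hX2 : 4 * X ≤ X ^ 2 := by rw [sq]; gcongr
  have hX3 : 4 * X ^ 2 ≤ X ^ 3 := by rw [pow_succ' X 2]; gcongr
  have hpow : 262144 * X ^ 3 ≤ (2 : ℝ) ^ P.p := by
    -- All magnitudes are O(X³). As X ≥ 4, the remaining X⁹ ≥ 4⁹ absorbs every absolute constant.
    have h1 : X ^ 12 ≤ (2 : ℝ) ^ P.p := by
      rw [hP]; exact pow_le_two_pow_ceil (by linarith)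
    have h2 : (4 : ℝ) ^ 9 ≤ X ^ 9 := by gcongr
    have h3 : (4 : ℝ) ^ 9 * X ^ 3 ≤ X ^ 9 * X ^ 3 := by gcongr
    have h4 : X ^ 9 * X ^ 3 = X ^ 12 := by ring
    norm_num at h3
    linarith
  have hulp : ∀ y : ℝ, y ≤ (2 : ℝ) ^ P.p → y * ulp P.p ≤ 1 := fun y hy => by
    rw [ulp, ← div_eq_mul_inv, div_le_one (by positivity)]; exact hy
  have hsq : ε ^ 2 ≤ ε := by rw [sq]; exact mul_le_of_le_one_right hε.le hε1.le
  obtain ⟨hL1, hL2⟩ : 32 * n / ε ≤ (2 : ℝ) ^ P.qLog ∧ (2 : ℝ) ^ P.qLog ≤ 2 * (32 * n / ε) := by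
    rw [hP]
    refine two_pow_ceil_logb ?_
    rw [le_div_iff₀ hε]; linarith
  obtain ⟨hI1, hI2⟩ : 2304 / ε ^ 2 ≤ (2 : ℝ) ^ P.qIter ∧
      (2 : ℝ) ^ P.qIter ≤ 2 * (2304 / ε ^ 2) := by
    rw [hP]
    refine two_pow_ceil_logb ?_
    rw [le_div_iff₀ (by positivity)]; linarith
  have hL3 : (2 : ℝ) ^ P.qLog ≤ 64 * X := by
    have : 2 * (32 * n / ε) = 64 * (n / ε) := by ring
    linarith
  have hI3 : (2 : ℝ) ^ P.qIter ≤ 4608 * X ^ 2 := by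
    have h1 : 2 * (2304 / ε ^ 2) = 4608 * (1 / ε) ^ 2 := by field_simp; norm_num
    have h2 : (1 / ε) ^ 2 ≤ X ^ 2 := by gcongr
    linarith
  have hlog2 := Real.log_two_gt_d9
  have hlogX : Real.log 4 ≤ Real.log X := Real.log_le_log (by norm_num) hX4
  have hlog4 : Real.log 4 = 2 * Real.log 2 := by
    rw [show (4 : ℝ) = 2 ^ 2 by norm_num, Real.log_pow]; norm_num
  refine ⟨?_, ?_, ?_, ?_, ?_, ?_, ?_, ?_, by linarith, ?_, by linarith⟩
  · have h1 : (P.p : ℝ) ≤ 18 * Real.log X + 1 := by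
      rw [hP]
      exact (Nat.ceil_lt_add_one (by linarith)).le
    unfold wordLength
    push_cast
    linarith
  · have : (2 : ℝ) ^ P.qLog ≤ 2 ^ P.p := by linarith
    exact (pow_le_pow_iff_right₀ (by norm_num)).1 this
  · rw [le_div_iff₀ (by positivity)]
    have := hulp (2 * 2 ^ P.qLog) (by linarith)
    linarith
  · have : (2 : ℝ) ^ P.qIter ≤ 2 ^ P.p := by linarith
    exact (pow_le_pow_iff_right₀ (by norm_num)).1 this
  · rw [le_div_iff₀ (by positivity)]
    have h1 : ((n : ℝ) + 3) * 2 ^ P.qIter ≤ (2 * X) * (4608 * X ^ 2) := by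
      gcongr; linarith
    have := hulp ((n + 3) * 2 ^ P.qIter) (by
      have : (2 * X) * (4608 * X ^ 2) = 9216 * X ^ 3 := by ring
      linarith)
    linarith
  -- The truncation of order ε² is finer than the accuracy ε/1152 = (ε/4)/288 required by the
  -- analysis of a cycle.
  · rw [div_le_div_iff₀ (by positivity) (by norm_num)]
    rw [div_le_iff₀ (by positivity)] at hI1
    have : 2 ^ P.qIter * ε ^ 2 ≤ 2 ^ P.qIter * ε := by gcongr
    linarith
  · rw [div_le_div_iff₀ (by positivity) (by norm_num)]
    rw [div_le_iff₀ hε] at hL1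
    linarith
  · have hκε : κ / ε ^ 2 ≤ X * (1 / ε) := by
      have : κ / ε ^ 2 = κ / ε * (1 / ε) := by field_simp
      rw [this]; gcongr
    have h1 : k + 1 ≤ 9217 * (X * (1 / ε)) := by
      have : 1 ≤ X * (1 / ε) := one_le_mul_of_one_le_of_one_le (by linarith) hε1'
      linarith
    -- This factor ε cancels the surplus 1/ε in the bound on the number of cycles.
    have h2 : (n : ℝ) * (2 * κ) = 2 * (X * ε) := by rw [hXε]; ring
    have hsize : (k + 1) * (n * (2 * κ)) ≤ 18434 * X ^ 3 := by
      rw [h2]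
      calc (k + 1) * (2 * (X * ε)) ≤ 9217 * (X * (1 / ε)) * (2 * (X * ε)) := by gcongr
        _ = 18434 * X ^ 2 := by field_simp; ring
        _ ≤ 18434 * X ^ 3 := by linarith
    linarith
  · have h1 : μ * ulp P.p ≤ X * ε * ulp P.p := mul_le_mul_of_nonneg_right hμX (ulp_pos _).le
    have h2 := mul_le_mul_of_nonneg_right (hulp (20 * X) (by linarith)) hε.le
    linarith

/-! ### Assembling the algorithm -/

/-- The matrix of the truncated logarithms is admissible. -/
theorem isAdmissible_logMatrix {p : ℕ} {L : Fin n × Fin n → ℤ} (hdiag : ∀ i, A i i = 0)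
    (hrow : ∀ i, ∃ j, A i j ≠ 0) (hcol : ∀ j, ∃ i, A i j ≠ 0) :
    IsAdmissible (logMatrix p A L) where
  nonneg i j := by
    simp only [logMatrix, Matrix.of_apply]
    split_ifs <;> positivity
  diag i := by simp [logMatrix, hdiag]
  row i := by
    obtain ⟨j, hj⟩ := hrow i
    exact ⟨j, by simp [logMatrix, hj, Real.exp_pos]⟩
  col j := by
    obtain ⟨i, hi⟩ := hcol j
    exact ⟨i, by simp [logMatrix, hi, Real.exp_pos]⟩

/-- A zero column j would force row j to have sum zero after balancing, although it has a positive
entry. -/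
theorem IsBalanceable.exists_col_ne_zero (hA : ∀ i j, 0 ≤ A i j) (hrow : ∀ i, ∃ j, A i j ≠ 0)
    (hb : IsBalanceable A) (j : Fin n) : ∃ i, A i j ≠ 0 := by
  obtain ⟨d, hd, heq⟩ := hb
  by_contra! hc
  have h0 : colSum (scaled A d) j = 0 :=
    Finset.sum_eq_zero fun i _ => by rw [scaled_apply, hc i]; simp
  obtain ⟨l, hl⟩ := hrow j
  have hpos : 0 < rowSum (scaled A d) j := by
    refine Finset.sum_pos' (fun i _ => ?_) ⟨l, Finset.mem_univ _, ?_⟩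
    · rw [scaled_apply]
      exact mul_nonneg (mul_nonneg (hd _).le (hA _ _)) (inv_nonneg.2 (hd _).le)
    · rw [scaled_apply]
      exact mul_pos (mul_pos (hd _) (lt_of_le_of_ne (hA _ _) (Ne.symm hl))) (inv_pos.2 (hd _))
  rw [heq, h0] at hpos
  exact lt_irrefl _ hpos

/-- The specification of the whole algorithm, for every sufficient precision. -/
theorem runsWithin_osborne {P : Precision} {ε : ℝ} {Kmax : ℕ} (hn : 2 ≤ n)
    (hA : ∀ i j, 0 ≤ A i j) (hdiag : ∀ i, A i i = 0) (hrow : ∀ i, ∃ j, A i j ≠ 0)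
    (hcol : ∀ j, ∃ i, A i j ≠ 0) (hε : 0 < ε) (hε1 : ε < 1)
    (hqL : P.qLog ≤ P.p) (hulpL : 2 * ulp P.p ≤ 1 / 2 ^ P.qLog)
    (hq : P.qIter ≤ P.p) (hulp : (n + 3) * ulp P.p ≤ 1 / 2 ^ P.qIter)
    (hδ : 2 / 2 ^ P.qIter ≤ ε / 1152)
    (hU : 4 * ((Kmax + 1) * (n * (2 * kappa A)) + Real.log (kappa A) + n + 2) < 2 ^ P.p)
    (hκ : kappa A + 1 < 2 ^ P.p)
    (hm : 20 * (nnz A * ulp P.p) ≤ ε) (hm' : 2 * (nnz A : ℝ) + 4 < 2 ^ P.p)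
    (hK : 9216 * (Real.log (kappa A) / ε * minInvDiam A ε) < Kmax + 1)
    (σ : ℕ → Equiv.Perm (Fin n)) :
    RunsWithin (osborne P A ε σ (Kmax + 1))
      (3 * nnz A + (1 + (Kmax + 1) * (46 * nnz A))) fun r =>
      ∃ L : Fin n × Fin n → ℤ,
        (∀ i j, A i j ≠ 0 → val P.p (L (i, j)) ≤ Real.log (A i j / minEntry A) ∧
          Real.log (A i j / minEntry A) - 2 / 2 ^ P.qLog ≤ val P.p (L (i, j))) ∧
        imbalance (expScaled (logMatrix P.p A L) (vals P.p r.2)) ≤ 3 / 4 * ε ∧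
        ∃ v : ℕ → ℕ → Fin n → ℝ,
          IsInexactOsborne (logMatrix P.p A L) σ (2 / 2 ^ P.qIter) r.1 v ∧
            v r.1 0 = vals P.p r.2 := by
  have hn0 : 0 < n := by omega
  obtain ⟨hmin, hle⟩ := minEntry_spec hn0 hA hrow
  have hnκ := card_le_kappa hn0 hA hrow
  have hκ2 : 2 ≤ kappa A := le_trans (by exact_mod_cast hn) hnκ
  unfold osborne
  refine (runsWithin_logEntries hn0 hA hrow hqL hulpL hκ).bind ?_
  intro L hL
  refine (runsWithin_emit_floor (y := ε) ?_).bind ?_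
  · rw [abs_of_pos hε]; linarith
  rintro _ rfl
  have hapos : ∀ i j, A i j ≠ 0 → 0 < A i j / minEntry A := fun i j hij =>
    div_pos (lt_of_le_of_ne (hA i j) (Ne.symm hij)) hmin
  have hLw : LogsWithin P.p A L (Real.log (kappa A)) := fun i j hij =>
    ⟨(hL i j hij).1, (hL i j hij).2.1.trans
      (Real.log_le_log (hapos i j hij) (div_minEntry_le_kappa hn0 hA hrow i j))⟩
  have hB : IsAdmissible (logMatrix P.p A L) := isAdmissible_logMatrix hdiag hrow hcol
  have hB1 : ∀ i j, 0 < logMatrix P.p A L i j → 1 ≤ logMatrix P.p A L i j := by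
    intro i j
    by_cases h : A i j = 0
    · simp [logMatrix, h]
    · simp [logMatrix, h, (hL i j h).1]
  have hBκ : total (logMatrix P.p A L) ≤ kappa A := by
    rw [← total_div_minEntry]
    refine Finset.sum_le_sum fun i _ => Finset.sum_le_sum fun j _ => ?_
    by_cases h : A i j = 0
    · simp [logMatrix, h]
    · simp only [logMatrix, Matrix.of_apply, if_pos h]
      exact (Real.le_log_iff_exp_le (hapos i j h)).1 (hL i j h).2.1
  have hlogκ : Real.log (kappa A) ≤ kappa A - 1 := Real.log_le_sub_one_of_pos (by linarith)
  -- W = 2κ is a crude bound for ½ log κ plus the update error; only its polynomial size matters.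
  refine (runsWithin_loop (Kmax := Kmax) (κ := kappa A) (W := 2 * kappa A) hn0 hκ2 hLw hB hB1
    hBκ hrow hcol hq hulp (by linarith) hU hε hε1 (val_floor_le _ _) (sub_ulp_le_val_floor _ _)
    hm hm' σ ?_ (Kmax + 1) 0 (by omega) (fun _ => 0) (by simp [vals, val_zero])
    (fun _ _ => 0) ⟨rfl, by simp, by simp⟩ (by ext; simp [vals, val_zero])
    (by simp)).mono le_rfl ?_
  · intro N v hv him
    have := hv.card_cycles_le (A := A) hn hB (fun i j hij => by simp [logMatrix, hij, Real.exp_pos]) hB1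
      hκ2 hBκ hε hε1 (by positivity) hδ him
    have h2 : (N : ℝ) < (Kmax + 1 : ℕ) := by push_cast; linarith
    have h3 : N < Kmax + 1 := by exact_mod_cast h2
    omega
  · rintro r ⟨h1, h2⟩
    exact ⟨L, fun i j hij => (hL i j hij).2, h1, h2⟩

/-- A balancing of the matrix of truncated logarithms is a balancing of `A`. -/
theorem isEpsBalancing_of_logMatrix {p q : ℕ} {L : Fin n × Fin n → ℤ} {ε : ℝ} (hn : 0 < n)
    (hA : ∀ i j, 0 ≤ A i j) (hdiag : ∀ i, A i i = 0) (hrow : ∀ i, ∃ j, A i j ≠ 0)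
    (hcol : ∀ j, ∃ i, A i j ≠ 0) (hε1 : ε < 1) (hq : 2 / 2 ^ q ≤ ε / 32)
    (hL : ∀ i j, A i j ≠ 0 → val p (L (i, j)) ≤ Real.log (A i j / minEntry A) ∧
      Real.log (A i j / minEntry A) - 2 / 2 ^ q ≤ val p (L (i, j))) {u : Fin n → ℤ}
    (hu : imbalance (expScaled (logMatrix p A L) (vals p u)) ≤ 3 / 4 * ε) :
    IsEpsBalancing A ε fun i => Real.exp (val p (u i)) := by
  obtain ⟨hmin, -⟩ := minEntry_spec hn hA hrow
  have hB : IsAdmissible (logMatrix p A L) := isAdmissible_logMatrix hdiag hrow hcol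
  refine ⟨fun i => Real.exp_pos _, ?_⟩
  change imbalance (expScaled A (vals p u)) ≤ ε
  set θ : ℝ := 2 / 2 ^ q with hθ
  have hθ0 : 0 ≤ θ := by positivity
  have hexp : Real.exp θ ≤ 1 + 2 * θ := by
    have := Real.abs_exp_sub_one_le (x := θ) (by rw [abs_of_nonneg hθ0]; linarith)
    rw [abs_of_nonneg hθ0] at this
    linarith [(abs_le.1 this).2]
  have hentry : ∀ i j, minEntry A * logMatrix p A L i j ≤ A i j ∧
      A i j ≤ minEntry A * (1 + 2 * θ) * logMatrix p A L i j := by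
    intro i j
    by_cases h : A i j = 0
    · simp [logMatrix, h]
    · obtain ⟨h1, h2⟩ := hL i j h
      have hpos : 0 < A i j / minEntry A :=
        div_pos (lt_of_le_of_ne (hA i j) (Ne.symm h)) hmin
      simp only [logMatrix, Matrix.of_apply, if_pos h]
      constructor
      · have := (Real.le_log_iff_exp_le hpos).1 h1
        rwa [le_div_iff₀ hmin, mul_comm] at this
      · have h3 : A i j / minEntry A ≤ Real.exp (θ + val p (L (i, j))) :=
          (Real.log_le_iff_le_exp hpos).1 (by linarith)
        rw [Real.exp_add, div_le_iff₀ hmin] at h3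
        have h4 := mul_le_mul_of_nonneg_right hexp
          (mul_nonneg (Real.exp_pos (val p (L (i, j)))).le hmin.le)
        linarith
  -- With τ = 2θ the imbalance grows by at most 4θ ≤ ε/8, within the margin ε/4 left by the test.
  have := imbalance_le_add (M := expScaled (logMatrix p A L) (vals p u))
    (M' := expScaled A (vals p u)) (τ := 2 * θ) hmin (by positivity) (hB.total_pos _ hn)
    (fun i j => by
      rw [expScaled_apply, expScaled_apply, ← mul_assoc]
      exact mul_le_mul_of_nonneg_right (hentry i j).1 (Real.exp_pos _).le)
    (fun i j => by
      rw [expScaled_apply, expScaled_apply, ← mul_assoc]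
      exact mul_le_mul_of_nonneg_right (hentry i j).2 (Real.exp_pos _).le)
  linarith

end Osborne

theorem theorem2 :
    ∃ c₁ c₂ c₃ C : ℝ, 0 < c₁ ∧ 0 < c₂ ∧ 0 < c₃ ∧ 0 < C ∧
      ∀ (n : ℕ) (A : Matrix (Fin n) (Fin n) ℝ) (ε : ℝ),
        2 ≤ n → (∀ i j, 0 ≤ A i j) → (∀ i, A i i = 0) → (∀ i, ∃ j, A i j ≠ 0) →
        Osborne.IsBalanceable A → 0 < ε → ε < 1 →
        -- the precisions depend only on `n`, `κ` and `ε`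
        ∀ P : Osborne.Precision, P = Osborne.Precision.choose c₁ c₂ c₃ n (Osborne.kappa A) ε →
          -- all numbers have `O(log (n κ / ε))` bits
          (Osborne.wordLength P.p : ℝ) ≤ C * Real.log (n * Osborne.kappa A / ε) ∧
          -- for all orderings, possibly different in each cycle
          ∀ σ : ℕ → Equiv.Perm (Fin n), ∃ (T K : ℕ) (u : Fin n → ℤ),
            Osborne.HaltsWith P A ε σ T K u ∧
            -- the number of operations
            (T : ℝ) ≤ C * (Osborne.nnz A * Real.log (Osborne.kappa A) / ε
              * Osborne.minInvDiam A ε) ∧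
            -- the output is an `ε`-balancing of `A`
            Osborne.IsEpsBalancing A ε (fun i => Real.exp (Osborne.val P.p (u i))) ∧
            -- the output is that of `K` cycles of Osborne's algorithm, with truncated
            -- log-entries (up to scaling `A`) and truncated iterates
            ∃ (B : Matrix (Fin n) (Fin n) ℝ) (v : ℕ → ℕ → Fin n → ℝ),
              (∀ i j, A i j = 0 → B i j = 0) ∧
              (∀ i j, A i j ≠ 0 → 0 < B i j ∧
                |Real.log (B i j) - Real.log (A i j / Osborne.minEntry A)| ≤ 2 / 2 ^ P.qLog) ∧
              Osborne.IsInexactOsborne B σ (2 / 2 ^ P.qIter) K v ∧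
              v K 0 = fun i => Osborne.val P.p (u i) := by
  open Osborne in
  -- 18 gives 2^p ≥ (nκ/ε)¹²; 32 and 2304 give the tolerances ε/32 and ε/1152; 500000 exceeds 9216 ·
  -- 46, the cycle bound times the cost per nonzero entry of a cycle with its test, plus lower-order
  -- terms.
  refine ⟨18, 32, 2304, 500000, by norm_num, by norm_num, by norm_num, by norm_num, ?_⟩
  intro n A ε hn hA hdiag hrow hbal hε hε1 P hP
  have hn0 : 0 < n := by omega
  have hcol := hbal.exists_col_ne_zero hA hrow
  have hn2 : (2 : ℝ) ≤ n := by exact_mod_cast hn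
  have hnκ := card_le_kappa hn0 hA hrow
  have hκ2 : 2 ≤ kappa A := hn2.trans hnκ
  have hlogκ : Real.log (kappa A) ≤ kappa A - 1 := Real.log_le_sub_one_of_pos (by linarith)
  have hlog2 := Real.log_two_gt_d9
  have hlogκ2 : Real.log 2 ≤ Real.log (kappa A) := Real.log_le_log (by norm_num) hκ2
  have hmid1 := one_le_minInvDiam hn A hε hε1
  have hmid2 := minInvDiam_le A hε
  set Y : ℝ := Real.log (kappa A) / ε * minInvDiam A ε with hY
  have hYlow : Real.log (kappa A) ≤ Y := by
    have h1 : Real.log (kappa A) ≤ Real.log (kappa A) / ε :=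
      le_div_self (by linarith) hε hε1.le
    exact h1.trans (le_mul_of_one_le_right (by linarith) hmid1)
  have hYup : Y ≤ kappa A / ε ^ 2 := by
    have h1 : kappa A / ε ^ 2 = kappa A / ε * (1 / ε) := by field_simp
    rw [hY, h1]
    gcongr
    linarith
  set Kmax : ℕ := ⌊9216 * Y⌋₊ with hKmax
  have hY0 : 0 ≤ 9216 * Y := by linarith
  have hK1 : (Kmax : ℝ) ≤ 9216 * Y := Nat.floor_le hY0
  have hK2 : 9216 * Y < Kmax + 1 := Nat.lt_floor_add_one _
  obtain ⟨b1, b2, b3, b4, b5, b6, b7, b8, b9, b10, b11⟩ :=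
    Precision.choose_bounds (μ := nnz A) (k := Kmax) hn hnκ hε hε1
      (by exact_mod_cast nnz_le A) (by linarith) hP
  refine ⟨b1, fun σ => ?_⟩
  obtain ⟨r, T, hrun, hT, L, hL, himb, v, hv, hvr⟩ := runsWithin_osborne (P := P) (Kmax := Kmax)
    hn hA hdiag hrow hcol hε hε1 b2 b3 b4 b5 b6 b8 b9 b10 b11 hK2 σ 0
  refine ⟨T, r.1, r.2, ⟨Kmax + 1, ?_⟩, ?_, ?_, logMatrix P.p A L, v, ?_, ?_, hv, hvr⟩
  · rw [hrun, zero_add]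
  · have hm1 : (1 : ℝ) ≤ nnz A := by
      obtain ⟨j, hj⟩ := hrow ⟨0, hn0⟩
      have : 0 < nnz A := by
        rw [← length_edges]
        exact List.length_pos_of_mem (mem_edges (e := (⟨0, hn0⟩, j)).2 hj)
      exact_mod_cast this
    have hT' : (T : ℝ) ≤ 3 * nnz A + (1 + (Kmax + 1) * (46 * nnz A)) := by exact_mod_cast hT
    have e1 : (nnz A : ℝ) * Real.log (kappa A) / ε * minInvDiam A ε = nnz A * Y := by
      rw [hY]; ring
    rw [e1]
    have h1 : ((Kmax : ℝ) + 1) * (46 * nnz A) ≤ (9216 * Y + 1) * (46 * nnz A) := by gcongr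
    have h2 : (nnz A : ℝ) * (1 / 2) ≤ nnz A * Y := by
      gcongr; linarith
    linarith
  · exact isEpsBalancing_of_logMatrix (q := P.qLog) hn0 hA hdiag hrow hcol hε1 b7 hL himb
  · intro i j hij
    simp [logMatrix, hij]
  · intro i j hij
    obtain ⟨h1, h2⟩ := hL i j hij
    simp only [logMatrix, Matrix.of_apply, if_pos hij, Real.log_exp]
    refine ⟨Real.exp_pos _, ?_⟩
    rw [abs_le]
    have : (0 : ℝ) ≤ 2 / 2 ^ P.qLog := by positivity
    constructor <;> linarith
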